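/- Let $C$ be an algebraically closed field of characteristic zero and let $C(x)[D]$ be the Ore algebra of linear differential operators with $Da=aD+a'$ for $a\in C(x)$. For $L=\sum_{i\le r}\ell_iD^i$ with $\ell_r\ne0$ put $\operatorname{ord}L=r$; a point $\xi\in C$ is an ordinary point of $L$ if it is not a pole of any $\ell_i/\ell_r$. $L$ is a right factor of $M$ if $M=AL$ for some $A\in C(x)[D]$. An operator is primitive if its coefficients are coprime polynomials in $C[x]$ and its leading coefficient is monic. The symmetric product $L_1\otimes L_2$ is the primitive operator of least order that annihilates $f_1f_2$ whenever $f_1,f_2$ lie in a differential ring extension of $C(x)$ and $L_1\cdot f_1=0=L_2\cdot f_2$; $L^{\otimes s}$ is the $s$-fold symmetric product, with $L^{\otimes 0}=D$. A least common left multiple (lclm) of $L_1,\dots,L_I$ is a nonzero common left multiple of least order. For $\xi \in C$ let $V_\xi(L)$ be the solution space of $L$ in $C((x-\xi))$, write $V=V_0$, and let $(V_\xi(M):V_\xi(L))=\{h\in C((x-\xi)) : hV_\xi(L)\subseteq V_\xi(M)\}$. An element of $C((x-\xi))$ is D-finite if a nonzero operator annihilates it; a minimal annihilator is a nonzero annihilating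 operator of least order. The global quasi-symmetric quotient of $M$ by $L$ is the unique primitive $Q$ of maximal order such that $L\otimes Q$ is a right factor of $M$. A local quasi-symmetric quotient of $M$ by $L$ at a common ordinary point $\xi$ is a primitive $Q$ such that $V_\xi(Q)=(V_\xi(M):V_\xi(L))$ and $L\otimes Q$ is a right factor of $M$. The indicial polynomial of $N$ at $0$ is the nonzero polynomial $p_0(s)$ with $N\cdot x^s=x^{s+\sigma}(p_0(s)+p_1(s)x+\cdots)$, and $T_k$ denotes truncation of a Laurent series after the term $x^k$. Algorithm 1 (input $M,L$ of positive order, both having $0$ as an ordinary point). (1) Set $r=\operatorname{ord}L$, $\delta=\dim_C(V(M):V(L))$; if $\delta=0$ return $1$. (2) Let $N=M\otimes L^{\otimes(r-1)}$, let $z$ be the largest natural number that is a root of the indicial polynomial of $N$ at $0$, set $k=z-\frac{r(r-1)}2+1$, and let $d_0$ be any upper bound for the degrees of the coefficients of a global quasi-symmetric quotient of $M$ by $L$ of order $\delta$, if there is one. (3) Take $h_j=T_k(b_j)$ for some basis $b_1,\dots,b_\delta$ of $(V(M):V(L))$, and put $d=\min\{d_0,\lfloor (k-\delta)/(\delta+1)\rfloor\}$.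 Find a primitive $Q=q_0+\cdots+q_\delta D^\delta$ with $q_i\in C[x]$, $\deg q_i\le d$ and $Q\cdot h_j=O(x^{k-\delta})$ for all $j$, or decide that there is none. If there is none and $k\ge(\delta+1)(d_0+1)+\delta$, return None. If $Q$ is found, $\operatorname{ord}Q=\delta$ and $L\otimes Q$ is a right factor of $M$, return $Q$. Otherwise replace $k$ by $2k$ and repeat (3). Algorithm 2 (input $M,L$ of positive order). Choose any common ordinary point $\xi\in C$ of $L$ and $M$, substitute $x\to x+\xi$ to obtain $L_\xi,M_\xi$, and run Algorithm 1 on $M_\xi,L_\xi$. If it returns None, return Fail; otherwise substitute $x\to x-\xi$ in its output and return the result. Theorem. Let $L,M\in C(x)[D]$ be of positive order, and suppose that $L$ is an lclm of finitely many first-order operators in $C(x)[D]$. Then, for all admissible choices of $\xi$ and all admissible outputs of the subroutines, Algorithm 2 terminates and returns the global quasi-symmetric quotient of $M$ by $L$ (which exists and is unique). Moreover, at every common ordinary point $\xi\in C$ of $L$ and $M$: every $h\in(V_\xi(M):V_\xi(L))$ is D-finite; every minimal annihilator $Q_h$ of such an $h$ satisfies $V_\xi(Q_h)\subseteq(V_\xi(M):V_\xi(L))$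 and $\dim_CV_\xi(Q_h)=\operatorname{ord}Q_h$; and a local quasi-symmetric quotient of $M$ by $L$ at $\xi$ exists. -/

import Mathlib

universe u

noncomputable section

open Polynomial

namespace SymmetricDivision

variable {C : Type u} [Field C]

/-! ### The differential fields `C(x)` and `C((x))` -/

/-- The derivative `d/dx` of a rational function, by the quotient rule. -/
def ratDeriv (f : RatFunc C) : RatFunc C :=
  algebraMap C[X] (RatFunc C) (derivative f.num * f.denom - f.num * derivative f.denom) /
    algebraMap C[X] (RatFunc C) f.denom ^ 2

theorem ratDeriv_div (p q : C[X]) (hq : q ≠ 0) :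
    ratDeriv (algebraMap C[X] (RatFunc C) p / algebraMap C[X] (RatFunc C) q) =
      algebraMap C[X] (RatFunc C) (derivative p * q - p * derivative q) /
        algebraMap C[X] (RatFunc C) q ^ 2 := by
  set f := algebraMap C[X] (RatFunc C) p / algebraMap C[X] (RatFunc C) q with hf
  have hd : f.denom ≠ 0 := f.denom_ne_zero
  have h1 : f.num * q = p * f.denom := RatFunc.num_mul_eq_mul_denom_iff hq |>.2 hf
  have h2 := congrArg derivative h1
  rw [Polynomial.derivative_mul, Polynomial.derivative_mul] at h2
  have hq' : algebraMap C[X] (RatFunc C) q ≠ 0 := RatFunc.algebraMap_ne_zero hq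
  have hd' : algebraMap C[X] (RatFunc C) f.denom ≠ 0 := RatFunc.algebraMap_ne_zero hd
  rw [ratDeriv, div_eq_div_iff (pow_ne_zero 2 hd') (pow_ne_zero 2 hq'), ← map_pow, ← map_pow,
    ← map_mul, ← map_mul]
  congr 1
  linear_combination (q * f.denom) * h2 - (derivative q * f.denom + q * derivative f.denom) * h1

/-- A differential ring from an additive map that satisfies the Leibniz rule. -/
abbrev mkDifferential {R : Type*} [CommRing R] (d : R →+ R)
    (h : ∀ a b, d (a * b) = a * d b + b * d a) : Differential R :=
  ⟨Derivation.mk' d.toIntLinearMap h⟩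

theorem differential_leibniz {R : Type*} [CommRing R] [Differential R] (a b : R) :
    Differential.deriv (a * b) = a * Differential.deriv b + b * Differential.deriv a := by
  rw [Derivation.leibniz, smul_eq_mul, smul_eq_mul]

/-- `C(x)` with the derivation `d/dx`. -/
instance instDifferentialRatFunc : Differential (RatFunc C) :=
  mkDifferential
    (AddMonoidHom.mk' ratDeriv (by
      intro f g
      induction f using RatFunc.induction_on with | f p q hq => ?_
      induction g using RatFunc.induction_on with | f r s hs => ?_
      have hq' : algebraMap C[X] (RatFunc C) q ≠ 0 := RatFunc.algebraMap_ne_zero hq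
      have hs' : algebraMap C[X] (RatFunc C) s ≠ 0 := RatFunc.algebraMap_ne_zero hs
      rw [div_add_div _ _ hq' hs', ← map_mul, ← map_mul, ← map_mul, ← map_add,
        ratDeriv_div _ _ (mul_ne_zero hq hs), ratDeriv_div _ _ hq, ratDeriv_div _ _ hs]
      simp only [Polynomial.derivative_mul, map_add, map_sub, map_mul]
      field_simp
      ring))
    (by
      intro f g
      change ratDeriv (f * g) = f * ratDeriv g + g * ratDeriv f
      induction f using RatFunc.induction_on with | f p q hq => ?_
      induction g using RatFunc.induction_on with | f r s hs => ?_
      have hq' : algebraMap C[X] (RatFunc C) q ≠ 0 := RatFunc.algebraMap_ne_zero hq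
      have hs' : algebraMap C[X] (RatFunc C) s ≠ 0 := RatFunc.algebraMap_ne_zero hs
      rw [div_mul_div_comm, ← map_mul, ← map_mul, ratDeriv_div _ _ (mul_ne_zero hq hs),
        ratDeriv_div _ _ hq, ratDeriv_div _ _ hs]
      simp only [Polynomial.derivative_mul, map_add, map_sub, map_mul]
      field_simp
      ring)

theorem coeff_laurentDerivative (f : LaurentSeries C) (n : ℤ) :
    (LaurentSeries.derivative C f).coeff n = ((n + 1 : ℤ) : C) * f.coeff (n + 1) := by
  simp [LaurentSeries.derivative_apply]

theorem laurentDerivative_mul (f g : LaurentSeries C) :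
    LaurentSeries.derivative C (f * g) =
      f * LaurentSeries.derivative C g + g * LaurentSeries.derivative C f := by
  have key : ∀ h : LaurentSeries C, ∀ n : ℤ,
      (HahnSeries.single (1 : ℤ) (1 : C) * LaurentSeries.derivative C h).coeff n =
        (n : C) * h.coeff n := by
    intro h n
    have := HahnSeries.coeff_single_mul_add (r := (1 : C))
      (x := LaurentSeries.derivative C h) (a := n - 1) (b := (1 : ℤ))
    rw [sub_add_cancel] at this
    rw [this, coeff_laurentDerivative]
    simp
  have hsub : ∀ h : LaurentSeries C,
      (HahnSeries.single (1 : ℤ) (1 : C) * LaurentSeries.derivative C h).support ⊆ h.support := by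
    intro h n hn hn'
    exact hn (by rw [key, hn', mul_zero])
  have h0 : HahnSeries.single (1 : ℤ) (1 : C) ≠ 0 := by simp
  refine mul_left_cancel₀ h0 ?_
  rw [mul_add, mul_left_comm, mul_left_comm _ g, mul_comm g]
  ext n
  rw [key, HahnSeries.coeff_add, HahnSeries.coeff_mul,
    HahnSeries.coeff_mul_right' g.isPWO_support (hsub g),
    HahnSeries.coeff_mul_left' f.isPWO_support (hsub f), ← Finset.sum_add_distrib,
    Finset.mul_sum]
  refine Finset.sum_congr rfl fun ij hij => ?_
  rw [key, key, ← (Finset.mem_antidiagonal.1 hij).2.2]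
  push_cast
  ring

/-- `C((x))` with the derivation `d/dx`. -/
instance instDifferentialLaurentSeries : Differential (LaurentSeries C) :=
  mkDifferential (LaurentSeries.derivative C).toAddMonoidHom laurentDerivative_mul

theorem deriv_laurentSeries (f : LaurentSeries C) :
    Differential.deriv f = LaurentSeries.derivative C f := rfl

instance instIsScalarTowerLaurentSeries :
    IsScalarTower C (LaurentSeries C) (LaurentSeries C) where
  smul_assoc c f g := by
    rw [smul_eq_mul, smul_eq_mul, ← HahnSeries.single_zero_mul_eq_smul,
      ← HahnSeries.single_zero_mul_eq_smul, mul_assoc]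

/-- `C((x))` as a field extension of `C(x)`: expansion of rational functions at `0`. -/
instance instAlgebraRatFuncLaurentSeries : Algebra (RatFunc C) (LaurentSeries C) :=
  RatFunc.liftAlgebra C (LaurentSeries C)

theorem deriv_algebraMap_poly (p : C[X]) :
    Differential.deriv (algebraMap C[X] (LaurentSeries C) p) =
      algebraMap C[X] (LaurentSeries C) (derivative p) := by
  ext n
  rw [deriv_laurentSeries, coeff_laurentDerivative, Polynomial.algebraMap_hahnSeries_apply,
    Polynomial.algebraMap_hahnSeries_apply, PowerSeries.coeff_coe, PowerSeries.coeff_coe]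
  rcases lt_trichotomy n (-1) with hn | rfl | hn
  · rw [if_pos (by omega), if_pos (by omega), mul_zero]
  · simp
  · obtain ⟨m, rfl⟩ := Int.eq_ofNat_of_zero_le (show 0 ≤ n by omega)
    rw [if_neg (by omega), if_neg (by omega)]
    simp only [Polynomial.coeff_coe, Int.natAbs_natCast, Polynomial.coeff_derivative]
    rw [show ((m : ℤ) + 1).natAbs = m + 1 by omega]
    push_cast
    ring

instance instDifferentialAlgebraLaurentSeries :
    DifferentialAlgebra (RatFunc C) (LaurentSeries C) where
  deriv_algebraMap f := by
    induction f using RatFunc.induction_on with | f p q hq => ?_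
    have hq' : algebraMap C[X] (LaurentSeries C) q ≠ 0 := by
      rw [Ne, Polynomial.algebraMap_hahnSeries_injective ℤ |>.eq_iff' (map_zero _)]
      exact hq
    have e : ∀ a b : C[X], algebraMap (RatFunc C) (LaurentSeries C)
        (algebraMap C[X] (RatFunc C) a / algebraMap C[X] (RatFunc C) b) =
        algebraMap C[X] (LaurentSeries C) a / algebraMap C[X] (LaurentSeries C) b :=
      fun a b => RatFunc.algebraMap_apply_div a b
    rw [show Differential.deriv (algebraMap C[X] (RatFunc C) p / algebraMap C[X] (RatFunc C) q) =
      _ from ratDeriv_div p q hq, ← map_pow, e, e]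
    have h := congrArg Differential.deriv (div_mul_cancel₀
      (algebraMap C[X] (LaurentSeries C) p) hq')
    rw [differential_leibniz, deriv_algebraMap_poly, deriv_algebraMap_poly] at h
    rw [map_pow, eq_div_iff (pow_ne_zero 2 hq')]
    rw [map_sub, map_mul, map_mul, ← h]
    field_simp
    ring

/-! ### Linear differential operators -/

/-- The left `C(x)`-vector space `C(x)[D]`. The polynomial `∑ ℓᵢ Xⁱ` stands for the operator
`∑ ℓᵢ Dⁱ`, and `natDegree` is the order. The product of operators is `oreMul` (it is not the
commutative product of polynomials). -/
abbrev DiffOp (C : Type u) [Field C] : Type u := Polynomial (RatFunc C)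

/-- Left multiplication by `D`: `D ∘ (∑ bⱼ Dʲ) = ∑ (bⱼ Dʲ⁺¹ + bⱼ' Dʲ)`. -/
def dMul (L : DiffOp C) : DiffOp C :=
  X * L + Differential.mapCoeffs L

/-- The product `A L` in the Ore algebra `C(x)[D]`, where `D a = a D + a'`. -/
def oreMul (A L : DiffOp C) : DiffOp C :=
  A.sum fun i a => Polynomial.C a * dMul^[i] L

/-- `L` is a right factor of `M` in `C(x)[D]`. -/
def IsRightFactor (L M : DiffOp C) : Prop :=
  ∃ A : DiffOp C, M = oreMul A L

/-- The action `(∑ ℓᵢ Dⁱ) · f = ∑ ℓᵢ f⁽ⁱ⁾` on a differential ring over `C(x)`. -/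
def act {F : Type*} [CommRing F] [Differential F] [Algebra (RatFunc C) F]
    (L : DiffOp C) (f : F) : F :=
  L.sum fun i a => a • (Differential.deriv (R := F))^[i] f

/-- A primitive operator: its coefficients are coprime polynomials and the leading coefficient
is monic. -/
def IsPrimitiveOp (Q : DiffOp C) : Prop :=
  ∃ q : C[X][X], q.map (algebraMap C[X] (RatFunc C)) = Q ∧ q.IsPrimitive ∧ q.leadingCoeff.Monic

/-- `L` is a least common left multiple of the family `Ls` (fixed up to a factor in `C(x)`). -/
def IsLCLM {ι : Type*} (Ls : ι → DiffOp C) (L : DiffOp C) : Prop :=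
  L ≠ 0 ∧ (∀ i, IsRightFactor (Ls i) L) ∧
    ∀ L' : DiffOp C, L' ≠ 0 → (∀ i, IsRightFactor (Ls i) L') → L.natDegree ≤ L'.natDegree

/-- In every differential ring extension of `C(x)`, the operator `P` annihilates all products of
a solution of `L₁` and a solution of `L₂`. -/
def AnnihilatesProducts (L₁ L₂ P : DiffOp C) : Prop :=
  ∀ (F : Type u) [CommRing F] [Differential F] [Algebra (RatFunc C) F]
    [DifferentialAlgebra (RatFunc C) F] (f g : F),
    act L₁ f = 0 → act L₂ g = 0 → act P (f * g) = 0

/-- `P` is the symmetric product `L₁ ⊗ L₂`. -/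
def IsSymProd (L₁ L₂ P : DiffOp C) : Prop :=
  IsPrimitiveOp P ∧ AnnihilatesProducts L₁ L₂ P ∧
    ∀ P' : DiffOp C, P' ≠ 0 → AnnihilatesProducts L₁ L₂ P' → P.natDegree ≤ P'.natDegree

/-- `P` is the symmetric power `L^{⊗ s}`; the empty symmetric product is `D`, the neutral
element of `⊗`. -/
def IsSymPow (L : DiffOp C) : ℕ → DiffOp C → Prop
  | 0, P => P = X
  | s + 1, P => ∃ P₀, IsSymPow L s P₀ ∧ IsSymProd P₀ L P

/-- `L ⊗ Q` is a right factor of `M`. -/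
def SymProdIsRightFactor (L Q M : DiffOp C) : Prop :=
  ∃ P, IsSymProd L Q P ∧ IsRightFactor P M

/-! ### Points, solution spaces and colon spaces -/

/-- `ξ ∈ C` is an ordinary point of `L = ∑ ℓᵢ Dⁱ` of order `r`: it is not a pole of any
`ℓᵢ / ℓᵣ`. -/
def IsOrdinaryPoint (ξ : C) (L : DiffOp C) : Prop :=
  ∀ i, (L.coeff i / L.leadingCoeff).denom.eval ξ ≠ 0

/-- The substitution `x ↦ x + ξ` in rational functions. -/
def ratShift (ξ : C) : RatFunc C →+* RatFunc C :=
  RatFunc.mapRingHom (taylorAlgHom ξ)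
    (nonZeroDivisors_le_comap_nonZeroDivisors_of_injective _ (taylor_injective ξ))

/-- The substitution `x ↦ x + ξ` in operators. -/
def shift (ξ : C) (L : DiffOp C) : DiffOp C :=
  L.map (ratShift ξ)

/-- The solution space `V(L)` of `L` in `C((x))`. -/
def solutionSpace (L : DiffOp C) : Submodule C (LaurentSeries C) where
  carrier := {f | act L f = 0}
  zero_mem' := by
    have h : ∀ i : ℕ, (Differential.deriv (R := LaurentSeries C))^[i] 0 = 0 := fun i =>
      iterate_map_zero _ i
    simp [act, h, Polynomial.sum]
  add_mem' {f g} hf hg := by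
    have h : ∀ i : ℕ, (Differential.deriv (R := LaurentSeries C))^[i] (f + g) =
        (Differential.deriv (R := LaurentSeries C))^[i] f +
          (Differential.deriv (R := LaurentSeries C))^[i] g := fun i => iterate_map_add _ i f g
    have e : act L (f + g) = act L f + act L g := by
      simp only [act, h, smul_add, Polynomial.sum, Finset.sum_add_distrib]
    simp only [Set.mem_ofPred_eq] at hf hg ⊢
    rw [e, hf, hg, add_zero]
  smul_mem' c f hf := by
    have h : ∀ i : ℕ, (Differential.deriv (R := LaurentSeries C))^[i] (c • f) =
        c • (Differential.deriv (R := LaurentSeries C))^[i] f := by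
      intro i
      induction i with
      | zero => rfl
      | succ i ih =>
        rw [Function.iterate_succ_apply', Function.iterate_succ_apply', ih, deriv_laurentSeries,
          deriv_laurentSeries, map_smul]
    have e : act L (c • f) = c • act L f := by
      simp only [act, h, Polynomial.sum, Finset.smul_sum]
      refine Finset.sum_congr rfl fun i _ => ?_
      rw [Algebra.smul_def, Algebra.smul_def, mul_comm, smul_mul_assoc, mul_comm]
    simp only [Set.mem_ofPred_eq] at hf ⊢
    rw [e, hf, smul_zero]

/-- The solution space `V_ξ(L)` of `L` in `C((x - ξ))`, written as a space of Laurent series in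
the local variable `x - ξ`. -/
def solutionSpaceAt (ξ : C) (L : DiffOp C) : Submodule C (LaurentSeries C) :=
  solutionSpace (shift ξ L)

/-- The colon space `(V : U) = {h | h U ⊆ V}`. -/
def colonSpace {K : Type*} [CommRing K] [Module C K] [IsScalarTower C K K] (V : Submodule C K) (U : Set K) :
    Submodule C K where
  carrier := {h | ∀ g ∈ U, h * g ∈ V}
  zero_mem' g _ := by simp
  add_mem' ha hb g hg := by
    rw [add_mul]
    exact V.add_mem (ha g hg) (hb g hg)
  smul_mem' c h hh g hg := by
    rw [smul_mul_assoc]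
    exact V.smul_mem c (hh g hg)

/-- The colon space `(V_ξ(M) : V_ξ(L))` in `C((x - ξ))`. -/
def colonSpaceAt (ξ : C) (M L : DiffOp C) : Submodule C (LaurentSeries C) :=
  colonSpace (solutionSpaceAt ξ M) (solutionSpaceAt ξ L)

/-- `h ∈ C((x - ξ))` is D-finite. -/
def IsDFiniteAt (ξ : C) (h : LaurentSeries C) : Prop :=
  ∃ A : DiffOp C, A ≠ 0 ∧ h ∈ solutionSpaceAt ξ A

/-- `Q` is a minimal annihilator of `h ∈ C((x - ξ))`. -/
def IsMinimalAnnihilatorAt (ξ : C) (h : LaurentSeries C) (Q : DiffOp C) : Prop :=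
  Q ≠ 0 ∧ h ∈ solutionSpaceAt ξ Q ∧
    ∀ A : DiffOp C, A ≠ 0 → h ∈ solutionSpaceAt ξ A → Q.natDegree ≤ A.natDegree

/-! ### Quasi-symmetric quotients -/

/-- `Q` is a primitive operator of maximal order such that `L ⊗ Q` is a right factor of `M`. -/
def IsQuasiSymQuotient (M L Q : DiffOp C) : Prop :=
  IsPrimitiveOp Q ∧ SymProdIsRightFactor L Q M ∧
    ∀ P : DiffOp C, SymProdIsRightFactor L P M → P.natDegree ≤ Q.natDegree

/-- `Q` is a local quasi-symmetric quotient of `M` by `L` at `ξ`. -/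
def IsLocalQuasiSymQuotient (ξ : C) (M L Q : DiffOp C) : Prop :=
  IsPrimitiveOp Q ∧ solutionSpaceAt ξ Q = colonSpaceAt ξ M L ∧ SymProdIsRightFactor L Q M

/-! ### Indicial polynomial -/

/-- The polynomial `p` in `s` such that `p(s) x^{s+e}` is the term of exponent `s + e` of
`N · x^s`: the sum of `a s(s-1)⋯(s-i+1)` over the terms `a x^{e+i} D^i` of `N`. -/
def indicialCoeff (N : DiffOp C) (e : ℤ) : C[X] :=
  N.sum fun i a =>
    Polynomial.C ((algebraMap (RatFunc C) (LaurentSeries C) a).coeff (e + i)) *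
      descPochhammer C i

/-- `p` is the indicial polynomial of `N` at `0`: the first nonzero coefficient of `N · x^s`. -/
def IsIndicialPoly (N : DiffOp C) (p : C[X]) : Prop :=
  p ≠ 0 ∧ ∃ σ : ℤ, indicialCoeff N σ = p ∧ ∀ e < σ, indicialCoeff N e = 0

/-! ### The algorithm at the point `0`

The two algorithms are transition systems. A line that calls a subroutine may continue with any
output that meets the specification of the subroutine. -/

/-- The truncation `T_k`, which keeps the terms of exponent at most `k`. -/
def truncate (k : ℤ) (f : LaurentSeries C) : LaurentSeries C :=
  HahnSeries.truncLT (k + 1) f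

/-- Specification of `ColonSpaceDimension(M, L)`. -/
def IsColonSpaceDimension (M L : DiffOp C) (δ : ℕ) : Prop :=
  Module.rank C (colonSpace (solutionSpace M) (solutionSpace L : Set (LaurentSeries C))) = δ

/-- Specification of `BoundDegreeOfQuasiSymmetricQuotientCoeffs(M, L, δ)`: `d₀` bounds the degrees
of the coefficients of a global quasi-symmetric quotient of order `δ`. -/
def IsCoeffDegreeBound (M L : DiffOp C) (δ d₀ : ℕ) : Prop :=
  ∀ q : C[X][X], IsQuasiSymQuotient M L (q.map (algebraMap C[X] (RatFunc C))) →
    q.natDegree = δ → ∀ i, (q.coeff i).natDegree ≤ d₀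

/-- Specification of `ColonSpaceBasis(M, L, k)`: the truncations at precision `k` of the elements
of a basis of `(V(M) : V(L))`. -/
def IsColonSpaceBasis (M L : DiffOp C) {δ : ℕ} (k : ℤ) (h : Fin δ → LaurentSeries C) : Prop :=
  ∃ b : Module.Basis (Fin δ) C
      (colonSpace (solutionSpace M) (solutionSpace L : Set (LaurentSeries C))),
    ∀ j, h j = truncate k (b j : LaurentSeries C)

/-- `Q = q₀ + ⋯ + q_δ D^δ` is a primitive operator with `deg qᵢ ≤ d` and
`Q · hⱼ = O(x^{k-δ})` for all `j`. -/
def IsApproximantAnnihilator {δ : ℕ} (h : Fin δ → LaurentSeries C) (d k : ℤ) (Q : DiffOp C) :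
    Prop :=
  ∃ q : C[X][X], q.map (algebraMap C[X] (RatFunc C)) = Q ∧ q.IsPrimitive ∧
    q.leadingCoeff.Monic ∧ q.natDegree ≤ δ ∧ (∀ i n : ℕ, d < n → (q.coeff i).coeff n = 0) ∧
    ∀ j, ∀ n : ℤ, n < k - δ → (act Q (h j)).coeff n = 0

/-- Specification of `ApproximantAnnihilator(h₁, …, h_δ; d, …, d; k)`; `none` stands for `∅`. -/
def ApproximantAnnihilatorOutput {δ : ℕ} (h : Fin δ → LaurentSeries C) (d k : ℤ) :
    Option (DiffOp C) → Prop
  | none => ∀ Q, ¬ IsApproximantAnnihilator h d k Q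
  | some Q => IsApproximantAnnihilator h d k Q

/-- Specification of the initial precision: `k₀ = max Z_N - r(r-1)/2`, where
`N = M ⊗ L^{⊗(r-1)}`, `r` is the order of `L`, and `Z_N` is the set of the natural numbers that
are roots of the indicial polynomial of `N` at `0`. -/
def IsInitialPrecision (M L : DiffOp C) (k₀ : ℤ) : Prop :=
  ∃ (P N : DiffOp C) (p : C[X]) (z : ℕ),
    IsSymPow L (L.natDegree - 1) P ∧ IsSymProd M P N ∧ IsIndicialPoly N p ∧
    IsGreatest {k : ℕ | p.eval (k : C) = 0} z ∧
    k₀ = (z : ℤ) - ((L.natDegree * (L.natDegree - 1) / 2 : ℕ) : ℤ)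

/-- States of `QuasiSymmetricQuotientAtZero(M, L)`: the first line, the head of the loop with the
current values of `δ`, `d₀`, `k`, and a final state with the returned value (`none` is `None`). -/
inductive LocalState (C : Type u) [Field C] : Type u
  | entry : LocalState C
  | loop (δ d₀ : ℕ) (k : ℤ) : LocalState C
  | done (result : Option (DiffOp C)) : LocalState C

/-- The degree bound `d = min {d₀, ⌊(k - δ)/(δ + 1)⌋}` used in the loop. -/
def loopDegree (δ d₀ : ℕ) (k : ℤ) : ℤ :=
  min (d₀ : ℤ) ((k - δ) / (δ + 1))

/-- The steps of `QuasiSymmetricQuotientAtZero(M, L)`. -/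
inductive LocalStep (M L : DiffOp C) : LocalState C → LocalState C → Prop
  | dim_zero : IsColonSpaceDimension M L 0 → LocalStep M L .entry (.done (some 1))
  | enter_loop (δ d₀ : ℕ) (k₀ : ℤ) : IsColonSpaceDimension M L δ → 0 < δ →
      IsInitialPrecision M L k₀ → IsCoeffDegreeBound M L δ d₀ →
      LocalStep M L .entry (.loop δ d₀ (k₀ + 1))
  | return_none (δ d₀ : ℕ) (k : ℤ) (h : Fin δ → LaurentSeries C) :
      IsColonSpaceBasis M L k h →
      ApproximantAnnihilatorOutput h (loopDegree δ d₀ k) k none →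
      ((δ : ℤ) + 1) * (d₀ + 1) + δ ≤ k →
      LocalStep M L (.loop δ d₀ k) (.done none)
  | continue_none (δ d₀ : ℕ) (k : ℤ) (h : Fin δ → LaurentSeries C) :
      IsColonSpaceBasis M L k h →
      ApproximantAnnihilatorOutput h (loopDegree δ d₀ k) k none →
      k < ((δ : ℤ) + 1) * (d₀ + 1) + δ →
      LocalStep M L (.loop δ d₀ k) (.loop δ d₀ (2 * k))
  | return_some (δ d₀ : ℕ) (k : ℤ) (h : Fin δ → LaurentSeries C) (Q : DiffOp C) :
      IsColonSpaceBasis M L k h →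
      ApproximantAnnihilatorOutput h (loopDegree δ d₀ k) k (some Q) →
      Q.natDegree = δ ∧ SymProdIsRightFactor L Q M →
      LocalStep M L (.loop δ d₀ k) (.done (some Q))
  | continue_some (δ d₀ : ℕ) (k : ℤ) (h : Fin δ → LaurentSeries C) (Q : DiffOp C) :
      IsColonSpaceBasis M L k h →
      ApproximantAnnihilatorOutput h (loopDegree δ d₀ k) k (some Q) →
      ¬ (Q.natDegree = δ ∧ SymProdIsRightFactor L Q M) →
      LocalStep M L (.loop δ d₀ k) (.loop δ d₀ (2 * k))

/-! ### The global algorithm -/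

/-- States of `QuasiSymmetricQuotient(M, L)`: the first line, a run of the algorithm at `0` after
the choice of `ξ`, and a final state with the returned value (`none` is `Fail`). -/
inductive GlobalState (C : Type u) [Field C] : Type u
  | start : GlobalState C
  | running (ξ : C) (s : LocalState C) : GlobalState C
  | returned (result : Option (DiffOp C)) : GlobalState C

/-- The steps of `QuasiSymmetricQuotient(M, L)`. -/
inductive GlobalStep (M L : DiffOp C) : GlobalState C → GlobalState C → Prop
  | choose_point (ξ : C) : IsOrdinaryPoint ξ L → IsOrdinaryPoint ξ M →
      GlobalStep M L .start (.running ξ .entry)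
  | run (ξ : C) (s t : LocalState C) : LocalStep (shift ξ M) (shift ξ L) s t →
      GlobalStep M L (.running ξ s) (.running ξ t)
  | fail (ξ : C) : GlobalStep M L (.running ξ (.done none)) (.returned none)
  | transform_back (ξ : C) (Q : DiffOp C) :
      GlobalStep M L (.running ξ (.done (some Q))) (.returned (some (shift (-ξ) Q)))

/-- Every execution that starts in `s₀` is finite and, when no further step is possible, has
reached a state that satisfies `post`. -/
def AlwaysEndsIn {S : Type*} (step : S → S → Prop) (s₀ : S) (post : S → Prop) : Prop :=
  Acc (fun t s => step s t) s₀ ∧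
    ∀ s, Relation.ReflTransGen step s₀ s → (∀ t, ¬ step s t) → post s

end SymmetricDivision

end

open SymmetricDivision

noncomputable section

open Polynomial

namespace SymmetricDivision

variable {C : Type u} [Field C]

/-! ### The action of operators and the Ore product -/

section Action

variable {F : Type*} [CommRing F] [Differential F] [Algebra (RatFunc C) F]

/-! The colon space is cut out by one global operator. Replace each first-order operator by `D - uᵢ`
up to a left factor. At a common ordinary point of `L` and `M` both operators have full solution
spaces, and so has every right factor of either (`finrank_solutionSpace_of_oreMul`). Hence each `D -
uᵢ` has a solution `eᵢ ≠ 0` in `V(L)`. Minimality of `L` forces the `eᵢ` to span `V(L)`, since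
exponentials are annihilated by an operator of order at most the dimension of their span. So `h V(L)
⊆ V(M)` only has to be tested on the `eᵢ`, and `M · (h eᵢ) = (Mᵢ · h) eᵢ`, where `Mᵢ` is `M` with
`D` replaced by `D + uᵢ` (`act_expShift`).

The colon space is therefore the set of common solutions of the `Mᵢ`, that is, the solution space of
their greatest common right divisor `Q` (`exists_gcrd`, `solutionSpace_eq_colonSpace`). `Q` does not
depend on the point. It has a full solution space at every common ordinary point of `L` and `M`,
even one that is singular for `Q`, because it is a right factor of some `Mᵢ`, whose solutions are
those of `M` divided by `eᵢ`.

This yields everything about quotients. A Wronskian argument (`annihilatesProducts_of_finrank`)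
carries annihilation of products from Laurent series to all differential rings, so `L ⊗ Q` is a
right factor of `M`. A competitor `P`, viewed at a point that is ordinary for `P` too, satisfies
`V(P) ⊆ V(Q)`; this gives maximality, and uniqueness among primitive operators. Minimal annihilators
of elements of the colon space are right factors of `Q`.

For the algorithm, `δ = ord Q` throughout. `None` is impossible because `Q` itself meets the
approximation conditions once `k` reaches the threshold. A returned operator of order `δ` that
passes the test is `Q` by uniqueness. The loop ends because `k` starts positive
(`IsInitialPrecision.nonneg`) and doubles, while operators of bounded order and degree that
annihilate the colon space to high enough precision annihilate it exactly
(`IsQuotientAtZero.exists_precision`), and only `Q` does so. -/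

theorem act_add (A B : DiffOp C) (f : F) : act (A + B) f = act A f + act B f :=
  Polynomial.sum_add_index A B _ (fun _ => zero_smul _ _) (fun _ _ _ => add_smul _ _ _)

theorem act_zero (f : F) : act (0 : DiffOp C) f = 0 := Polynomial.sum_zero_index _

theorem act_C_mul_X_pow (a : RatFunc C) (n : ℕ) (f : F) :
    act (Polynomial.C a * X ^ n) f = a • (Differential.deriv (R := F))^[n] f :=
  by rw [C_mul_X_pow_eq_monomial]; exact
    Polynomial.sum_monomial_index a (fun i a => a • (Differential.deriv (R := F))^[i] f) (zero_smul _ _)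

theorem act_X_pow (n : ℕ) (f : F) :
    act (X ^ n : DiffOp C) f = (Differential.deriv (R := F))^[n] f := by
  simpa using act_C_mul_X_pow (1 : RatFunc C) n f

theorem act_C (a : RatFunc C) (f : F) : act (Polynomial.C a) f = a • f := by
  simpa using act_C_mul_X_pow a 0 f

theorem act_one (f : F) : act (1 : DiffOp C) f = f := by
  simpa using act_C (1 : RatFunc C) f

theorem act_X (f : F) : act (X : DiffOp C) f = Differential.deriv f := by
  simpa using act_X_pow (C := C) 1 f

theorem act_C_mul (a : RatFunc C) (A : DiffOp C) (f : F) :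
    act (Polynomial.C a * A) f = a • act A f := by
  induction A using Polynomial.induction_on' with
  | add p q hp hq => rw [mul_add, act_add, act_add, hp, hq, smul_add]
  | monomial n b =>
    rw [← C_mul_X_pow_eq_monomial, ← mul_assoc, ← C_mul, act_C_mul_X_pow, act_C_mul_X_pow, mul_smul]

theorem act_neg (A : DiffOp C) (f : F) : act (-A) f = -act A f := by
  have := act_C_mul (-1) A f
  simpa using this

theorem act_sub (A B : DiffOp C) (f : F) : act (A - B) f = act A f - act B f := by
  rw [sub_eq_add_neg, act_add, act_neg, ← sub_eq_add_neg]

theorem iterate_deriv_add (n : ℕ) (f g : F) :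
    (Differential.deriv (R := F))^[n] (f + g) =
      (Differential.deriv (R := F))^[n] f + (Differential.deriv (R := F))^[n] g :=
  iterate_map_add _ n f g

theorem act_add_right (A : DiffOp C) (f g : F) : act A (f + g) = act A f + act A g := by
  simp only [act, iterate_deriv_add, smul_add, Polynomial.sum, Finset.sum_add_distrib]

theorem act_zero_right (A : DiffOp C) : act A (0 : F) = 0 := by
  simpa using act_add_right A (0 : F) 0

theorem act_eq_sum_fin (A : DiffOp C) {r : ℕ} (h : A.degree < r) (f : F) :
    act A f = ∑ i : Fin r, A.coeff i • (Differential.deriv (R := F))^[i] f := by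
  rw [act, Polynomial.sum_def, Fin.sum_univ_eq_sum_range
    (fun i => A.coeff i • (Differential.deriv (R := F))^[i] f)]
  refine Finset.sum_subset (fun i hi => ?_) (fun i _ hi => ?_)
  · exact Finset.mem_range.2 (by
      have := (Polynomial.le_degree_of_mem_supp i hi).trans_lt h
      exact_mod_cast this)
  · rw [Polynomial.notMem_support_iff.1 hi, zero_smul]

theorem deriv_smul [DifferentialAlgebra (RatFunc C) F] (a : RatFunc C) (f : F) :
    Differential.deriv (a • f) = a • Differential.deriv f + Differential.deriv a • f := by
  rw [Algebra.smul_def, differential_leibniz, DifferentialAlgebra.deriv_algebraMap,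
    Algebra.smul_def, Algebra.smul_def]
  ring

end Action

/-! ### The ring laws of the Ore product -/

theorem dMul_add (A B : DiffOp C) : dMul (A + B) = dMul A + dMul B := by
  rw [dMul, dMul, dMul, mul_add, map_add]
  ring

theorem mapCoeffs_C_mul (a : RatFunc C) (A : DiffOp C) :
    Differential.mapCoeffs (Polynomial.C a * A) = Polynomial.C a * Differential.mapCoeffs A +
      Polynomial.C (Differential.deriv a) * A := by
  ext1 i
  rw [Differential.coeff_mapCoeffs, coeff_C_mul, coeff_add, coeff_C_mul, coeff_C_mul,
    Differential.coeff_mapCoeffs, differential_leibniz]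
  ring

theorem dMul_C_mul (a : RatFunc C) (A : DiffOp C) :
    dMul (Polynomial.C a * A) = Polynomial.C a * dMul A +
      Polynomial.C (Differential.deriv a) * A := by
  rw [dMul, dMul, mapCoeffs_C_mul]
  ring

theorem dMul_zero : dMul (0 : DiffOp C) = 0 := by
  rw [dMul, mul_zero, map_zero, add_zero]

theorem iterate_dMul_zero (n : ℕ) : dMul^[n] (0 : DiffOp C) = 0 :=
  Function.iterate_fixed dMul_zero n

theorem iterate_dMul_add (n : ℕ) (A B : DiffOp C) :
    dMul^[n] (A + B) = dMul^[n] A + dMul^[n] B := by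
  induction n generalizing A B with
  | zero => rfl
  | succ n ih => simp only [Function.iterate_succ_apply, dMul_add, ih]

/-- The value `∑ aᵢ Tⁱ(N)` of the operator `∑ aᵢ Dⁱ` when `D` is replaced by `T`. -/
def opEval (T : DiffOp C → DiffOp C) (A N : DiffOp C) : DiffOp C :=
  A.sum fun i a => Polynomial.C a * T^[i] N

theorem oreMul_eq_opEval (A L : DiffOp C) : oreMul A L = opEval dMul A L := rfl

theorem opEval_add (T : DiffOp C → DiffOp C) (A B N : DiffOp C) :
    opEval T (A + B) N = opEval T A N + opEval T B N :=
  Polynomial.sum_add_index A B _ (fun _ => by rw [C_0, zero_mul])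
    (fun _ _ _ => by rw [C_add, add_mul])

theorem opEval_C_mul_X_pow (T : DiffOp C → DiffOp C) (a : RatFunc C) (n : ℕ) (N : DiffOp C) :
    opEval T (Polynomial.C a * X ^ n) N = Polynomial.C a * T^[n] N := by
  rw [C_mul_X_pow_eq_monomial]
  exact Polynomial.sum_monomial_index a (fun i a => Polynomial.C a * T^[i] N)
    (by rw [C_0, zero_mul])

theorem opEval_monomial (T : DiffOp C → DiffOp C) (a : RatFunc C) (n : ℕ) (N : DiffOp C) :
    opEval T (monomial n a) N = Polynomial.C a * T^[n] N := by
  rw [← C_mul_X_pow_eq_monomial, opEval_C_mul_X_pow]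

theorem opEval_zero (T : DiffOp C → DiffOp C) (N : DiffOp C) : opEval T 0 N = 0 :=
  Polynomial.sum_zero_index _

theorem oreMul_add_left (A B N : DiffOp C) : oreMul (A + B) N = oreMul A N + oreMul B N :=
  opEval_add _ _ _ _

theorem oreMul_monomial (a : RatFunc C) (n : ℕ) (N : DiffOp C) :
    oreMul (monomial n a) N = Polynomial.C a * dMul^[n] N :=
  opEval_monomial _ _ _ _

theorem zero_oreMul (N : DiffOp C) : oreMul 0 N = 0 := opEval_zero _ _

theorem oreMul_add (A N P : DiffOp C) : oreMul A (N + P) = oreMul A N + oreMul A P := by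
  simp only [oreMul, Polynomial.sum_def, iterate_dMul_add, mul_add, Finset.sum_add_distrib]

theorem oreMul_zero (A : DiffOp C) : oreMul A (0 : DiffOp C) = 0 := by
  simp only [oreMul, Polynomial.sum_def, iterate_dMul_zero, mul_zero, Finset.sum_const_zero]

theorem oreMul_sum {ι : Type*} (s : Finset ι) (A : DiffOp C) (N : ι → DiffOp C) :
    oreMul A (∑ i ∈ s, N i) = ∑ i ∈ s, oreMul A (N i) := by
  classical
  induction s using Finset.induction_on with
  | empty => simp [oreMul_zero]
  | insert i s hi ih => rw [Finset.sum_insert hi, Finset.sum_insert hi, oreMul_add, ih]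

theorem C_mul_oreMul (a : RatFunc C) (A N : DiffOp C) :
    oreMul (Polynomial.C a * A) N = Polynomial.C a * oreMul A N := by
  induction A using Polynomial.induction_on' with
  | add p q hp hq => rw [mul_add, oreMul_add_left, oreMul_add_left, hp, hq, mul_add]
  | monomial n b =>
    rw [C_mul_monomial, oreMul_monomial, oreMul_monomial, ← mul_assoc, ← C_mul]

theorem C_oreMul (a : RatFunc C) (N : DiffOp C) :
    oreMul (Polynomial.C a) N = Polynomial.C a * N := by
  simpa using oreMul_monomial a 0 N

theorem one_oreMul (N : DiffOp C) : oreMul 1 N = N := by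
  simpa using C_oreMul (1 : RatFunc C) N

theorem neg_oreMul (A N : DiffOp C) : oreMul (-A) N = -oreMul A N := by
  simpa using C_mul_oreMul (-1) A N

theorem sub_oreMul (A B N : DiffOp C) : oreMul (A - B) N = oreMul A N - oreMul B N := by
  rw [sub_eq_add_neg, oreMul_add_left, neg_oreMul, sub_eq_add_neg]

theorem dMul_oreMul (A N : DiffOp C) : oreMul (dMul A) N = dMul (oreMul A N) := by
  induction A using Polynomial.induction_on' with
  | add p q hp hq => rw [dMul_add, oreMul_add_left, oreMul_add_left, dMul_add, hp, hq]
  | monomial n b =>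
    rw [dMul, X_mul_monomial, Differential.mapCoeffs_monomial, oreMul_add_left, oreMul_monomial,
      oreMul_monomial, oreMul_monomial, dMul_C_mul, Function.iterate_succ_apply']

theorem oreMul_assoc (A B N : DiffOp C) : oreMul (oreMul A B) N = oreMul A (oreMul B N) := by
  have key (n : ℕ) : oreMul (dMul^[n] B) N = dMul^[n] (oreMul B N) := by
    induction n with
    | zero => rfl
    | succ n ih =>
      rw [Function.iterate_succ_apply', Function.iterate_succ_apply', dMul_oreMul, ih]
  induction A using Polynomial.induction_on' with
  | add p q hp hq => rw [oreMul_add_left, oreMul_add_left, oreMul_add_left, hp, hq]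
  | monomial n b => rw [oreMul_monomial, oreMul_monomial, C_mul_oreMul, key]

section Action

variable {F : Type*} [CommRing F] [Differential F] [Algebra (RatFunc C) F]
  [DifferentialAlgebra (RatFunc C) F]

theorem act_dMul (A : DiffOp C) (f : F) : act (dMul A) f = Differential.deriv (act A f) := by
  induction A using Polynomial.induction_on' with
  | add p q hp hq => rw [dMul_add, act_add, act_add, map_add, hp, hq]
  | monomial n b =>
    rw [dMul, X_mul_monomial, Differential.mapCoeffs_monomial, act_add,
      ← C_mul_X_pow_eq_monomial, ← C_mul_X_pow_eq_monomial, ← C_mul_X_pow_eq_monomial,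
      act_C_mul_X_pow, act_C_mul_X_pow, act_C_mul_X_pow, deriv_smul, Function.iterate_succ_apply']

theorem act_oreMul (A N : DiffOp C) (f : F) : act (oreMul A N) f = act A (act N f) := by
  have key (n : ℕ) : act (dMul^[n] N) f = (Differential.deriv (R := F))^[n] (act N f) := by
    induction n with
    | zero => rfl
    | succ n ih =>
      rw [Function.iterate_succ_apply', Function.iterate_succ_apply', act_dMul, ih]
  induction A using Polynomial.induction_on' with
  | add p q hp hq => rw [oreMul_add_left, act_add, act_add, hp, hq]
  | monomial n b =>
    rw [oreMul_monomial, act_C_mul, key, ← C_mul_X_pow_eq_monomial, act_C_mul_X_pow]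

end Action

/-! ### Orders and division -/

theorem natDegree_mapCoeffs_le (N : DiffOp C) :
    (Differential.mapCoeffs N).natDegree ≤ N.natDegree := by
  refine natDegree_le_iff_coeff_eq_zero.2 fun i hi => ?_
  rw [Differential.coeff_mapCoeffs, coeff_eq_zero_of_natDegree_lt hi, map_zero]

theorem natDegree_leadingCoeff_of_sub_X_mul {N P : DiffOp C} (hN : N ≠ 0)
    (h : (P - X * N).natDegree ≤ N.natDegree) :
    P.natDegree = N.natDegree + 1 ∧ P.leadingCoeff = N.leadingCoeff := by
  have hX : (X * N).natDegree = N.natDegree + 1 := natDegree_X_mul hN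
  have hlt : (P - X * N).degree < (X * N).degree := by
    refine degree_lt_degree (by omega)
  have e : P = X * N + (P - X * N) := by ring
  constructor
  · rw [e, natDegree_add_eq_left_of_degree_lt hlt, hX]
  · rw [e, leadingCoeff_add_of_degree_lt' hlt, leadingCoeff_mul, leadingCoeff_X, one_mul]

/-- The hypothesis on `T` (multiplication by `X` up to terms of no higher order) holds for left
multiplication by `D` and by `D + u`. The order count thus serves both `oreMul` and `expShift`. -/
theorem natDegree_leadingCoeff_iterate {T : DiffOp C → DiffOp C}
    (hT : ∀ N, (T N - X * N).natDegree ≤ N.natDegree) {N : DiffOp C} (hN : N ≠ 0) (i : ℕ) :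
    (T^[i] N).natDegree = N.natDegree + i ∧ (T^[i] N).leadingCoeff = N.leadingCoeff := by
  induction i with
  | zero => exact ⟨rfl, rfl⟩
  | succ i ih =>
    have h0 : T^[i] N ≠ 0 := fun h => hN (by
      rw [← leadingCoeff_eq_zero, ← ih.2, h, leadingCoeff_zero])
    have := natDegree_leadingCoeff_of_sub_X_mul h0 (hT (T^[i] N))
    rw [Function.iterate_succ_apply', this.1, this.2, ih.1, ih.2]
    exact ⟨rfl, rfl⟩

theorem natDegree_opEval_le {T : DiffOp C → DiffOp C}
    (hT : ∀ N, (T N - X * N).natDegree ≤ N.natDegree) {N : DiffOp C} (hN : N ≠ 0) (A : DiffOp C) :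
    (opEval T A N).natDegree ≤ N.natDegree + A.natDegree := by
  refine natDegree_sum_le_of_forall_le _ _ fun i hi => ?_
  refine (natDegree_C_mul_le _ _).trans ?_
  rw [(natDegree_leadingCoeff_iterate hT hN i).1]
  exact Nat.add_le_add_left (le_natDegree_of_mem_supp i hi) _

theorem coeff_opEval {T : DiffOp C → DiffOp C}
    (hT : ∀ N, (T N - X * N).natDegree ≤ N.natDegree) {N : DiffOp C} (hN : N ≠ 0) (A : DiffOp C) :
    (opEval T A N).coeff (N.natDegree + A.natDegree) = A.leadingCoeff * N.leadingCoeff := by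
  rw [opEval, Polynomial.sum_def, finsetSum_coeff, Finset.sum_eq_single A.natDegree]
  · rw [coeff_C_mul, ← (natDegree_leadingCoeff_iterate hT hN A.natDegree).1]
    exact congrArg _ (natDegree_leadingCoeff_iterate hT hN A.natDegree).2
  · intro i hi hne
    rw [coeff_C_mul, coeff_eq_zero_of_natDegree_lt (p := T^[i] N), mul_zero]
    rw [(natDegree_leadingCoeff_iterate hT hN i).1]
    have := le_natDegree_of_mem_supp i hi
    omega
  · intro h
    rw [notMem_support_iff.1 h, C_0, zero_mul, coeff_zero]

theorem natDegree_opEval {T : DiffOp C → DiffOp C}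
    (hT : ∀ N, (T N - X * N).natDegree ≤ N.natDegree) {A N : DiffOp C} (hA : A ≠ 0) (hN : N ≠ 0) :
    (opEval T A N).natDegree = N.natDegree + A.natDegree :=
  natDegree_eq_of_le_of_coeff_ne_zero (natDegree_opEval_le hT hN A) (by
    rw [coeff_opEval hT hN]
    exact mul_ne_zero (leadingCoeff_ne_zero.2 hA) (leadingCoeff_ne_zero.2 hN))

theorem natDegree_dMul_sub (N : DiffOp C) : (dMul N - X * N).natDegree ≤ N.natDegree := by
  rw [dMul, add_sub_cancel_left]
  exact natDegree_mapCoeffs_le N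

theorem natDegree_oreMul {A N : DiffOp C} (hA : A ≠ 0) (hN : N ≠ 0) :
    (oreMul A N).natDegree = A.natDegree + N.natDegree := by
  rw [oreMul_eq_opEval, natDegree_opEval natDegree_dMul_sub hA hN, add_comm]

theorem oreMul_ne_zero {A N : DiffOp C} (hA : A ≠ 0) (hN : N ≠ 0) : oreMul A N ≠ 0 := by
  intro h
  have := coeff_opEval natDegree_dMul_sub hN A
  rw [← oreMul_eq_opEval, h, coeff_zero] at this
  exact mul_ne_zero (leadingCoeff_ne_zero.2 hA) (leadingCoeff_ne_zero.2 hN) this.symm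

/-- Right division with remainder in the Ore algebra. -/
theorem exists_oreMul_add_eq {L : DiffOp C} (hL : L ≠ 0) (M : DiffOp C) :
    ∃ A R : DiffOp C, M = oreMul A L + R ∧ R.degree < L.degree := by
  obtain ⟨n, hn⟩ : ∃ n : ℕ, M.degree < n := ⟨M.natDegree + 1, by
    refine degree_le_natDegree.trans_lt ?_
    exact_mod_cast Nat.lt_succ_self _⟩
  induction n generalizing M with
  | zero =>
    have : M = 0 := by simpa using hn
    exact ⟨0, 0, by rw [this, zero_oreMul, add_zero], by simpa [bot_lt_iff_ne_bot] using hL⟩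
  | succ n ih =>
    by_cases hlt : M.degree < L.degree
    · exact ⟨0, M, by rw [zero_oreMul, zero_add], hlt⟩
    have hM : M ≠ 0 := by
      rintro rfl
      exact hlt (by simpa [bot_lt_iff_ne_bot] using hL)
    have hle : L.natDegree ≤ M.natDegree := natDegree_le_natDegree (not_lt.1 hlt)
    set B : DiffOp C := monomial (M.natDegree - L.natDegree) (M.leadingCoeff / L.leadingCoeff)
      with hB
    have hlc : M.leadingCoeff / L.leadingCoeff ≠ 0 :=
      div_ne_zero (leadingCoeff_ne_zero.2 hM) (leadingCoeff_ne_zero.2 hL)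
    have hB0 : B ≠ 0 := by rwa [hB, Ne, monomial_eq_zero_iff]
    have hBd : B.natDegree = M.natDegree - L.natDegree := natDegree_monomial_eq _ hlc
    have hP : (oreMul B L).natDegree = M.natDegree := by
      rw [natDegree_oreMul hB0 hL, hBd]
      omega
    have hPl : (oreMul B L).leadingCoeff = M.leadingCoeff := by
      have := coeff_opEval natDegree_dMul_sub hL B
      rw [← oreMul_eq_opEval, add_comm, ← natDegree_oreMul hB0 hL, coeff_natDegree] at this
      rw [this, hB, leadingCoeff_monomial, div_mul_cancel₀ _ (leadingCoeff_ne_zero.2 hL)]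
    have hdeg : (M - oreMul B L).degree < M.degree := by
      refine degree_sub_lt_left ?_ hM hPl.symm
      rw [degree_eq_natDegree hM, degree_eq_natDegree (oreMul_ne_zero hB0 hL), hP]
    obtain ⟨A, R, h, hR⟩ := ih (M - oreMul B L) (by
      have h1 : M.degree ≤ n := Order.lt_succ_iff.1 (by exact_mod_cast hn)
      exact hdeg.trans_le h1)
    refine ⟨A + B, R, ?_, hR⟩
    rw [oreMul_add_left, add_right_comm, ← h, sub_add_cancel]

/-! ### The substitution `D ↦ D + u` -/

/-- The operator that is obtained from `M` when `D` is replaced by `D + u`. -/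
def expShift (u : RatFunc C) (M : DiffOp C) : DiffOp C :=
  opEval (fun N => dMul N + Polynomial.C u * N) M 1

theorem natDegree_expShift_aux (u : RatFunc C) (N : DiffOp C) :
    (dMul N + Polynomial.C u * N - X * N).natDegree ≤ N.natDegree := by
  rw [dMul, show X * N + Differential.mapCoeffs N + Polynomial.C u * N - X * N =
    Differential.mapCoeffs N + Polynomial.C u * N by ring]
  exact natDegree_add_le_of_degree_le (natDegree_mapCoeffs_le N) (natDegree_C_mul_le _ _)

theorem natDegree_expShift (u : RatFunc C) {M : DiffOp C} (hM : M ≠ 0) :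
    (expShift u M).natDegree = M.natDegree := by
  rw [expShift, natDegree_opEval (natDegree_expShift_aux u) hM one_ne_zero, natDegree_one, zero_add]

theorem expShift_ne_zero (u : RatFunc C) {M : DiffOp C} (hM : M ≠ 0) : expShift u M ≠ 0 := by
  intro h
  have := coeff_opEval (natDegree_expShift_aux u) (one_ne_zero (α := DiffOp C)) M
  rw [← expShift, h, coeff_zero, leadingCoeff_one, mul_one] at this
  exact leadingCoeff_ne_zero.2 hM this.symm

/-- By Leibniz, `(h e)' = (h' + u h) e`: conjugation by an exponential turns `D` into `D + u`. -/
theorem act_expShift {F : Type*} [CommRing F] [Differential F] [Algebra (RatFunc C) F]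
    [DifferentialAlgebra (RatFunc C) F] {u : RatFunc C} {e : F}
    (he : Differential.deriv e = u • e) (M : DiffOp C) (h : F) :
    act M (h * e) = act (expShift u M) h * e := by
  have key (n : ℕ) : (Differential.deriv (R := F))^[n] (h * e) =
      act ((fun N => dMul N + Polynomial.C u * N)^[n] 1) h * e := by
    induction n with
    | zero => rw [Function.iterate_zero_apply, Function.iterate_zero_apply, act_one]
    | succ n ih =>
      rw [Function.iterate_succ_apply', Function.iterate_succ_apply', ih, differential_leibniz, he,
        act_add, act_dMul, act_C_mul]
      simp only [Algebra.smul_def]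
      ring
  rw [expShift]
  induction M using Polynomial.induction_on' with
  | add p q hp hq => rw [act_add, opEval_add, act_add, hp, hq, add_mul]
  | monomial n b =>
    rw [opEval_monomial, ← C_mul_X_pow_eq_monomial, act_C_mul_X_pow, key, act_C_mul,
      smul_mul_assoc]

/-! ### Operators with Laurent series coefficients -/

theorem coeff_iterate_deriv (f : LaurentSeries C) (i : ℕ) (n : ℤ) :
    ((Differential.deriv (R := LaurentSeries C))^[i] f).coeff n =
      (descPochhammer C i).eval ((n + i : ℤ) : C) * f.coeff (n + i) := by
  induction i generalizing n with
  | zero => simp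
  | succ i ih =>
    rw [Function.iterate_succ_apply', deriv_laurentSeries, coeff_laurentDerivative, ih,
      descPochhammer_succ_right, eval_mul, eval_sub, eval_X, eval_natCast,
      show n + 1 + (i : ℤ) = n + ((i + 1 : ℕ) : ℤ) by push_cast; ring]
    push_cast
    ring

theorem iterate_deriv_smul (c : C) (f : LaurentSeries C) (i : ℕ) :
    (Differential.deriv (R := LaurentSeries C))^[i] (c • f) =
      c • (Differential.deriv (R := LaurentSeries C))^[i] f := by
  ext n
  rw [coeff_iterate_deriv, HahnSeries.coeff_smul, HahnSeries.coeff_smul, coeff_iterate_deriv,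
    smul_eq_mul, smul_eq_mul]
  ring

theorem mul_smul_laurentSeries (c : C) (f g : LaurentSeries C) : f * c • g = c • (f * g) := by
  rw [mul_comm, smul_mul_assoc, mul_comm]

theorem coeff_iterate_deriv_eq_zero {f : LaurentSeries C} {t : ℤ} (hf : ∀ n < t, f.coeff n = 0)
    (i : ℕ) {n : ℤ} (hn : n < t - i) :
    ((Differential.deriv (R := LaurentSeries C))^[i] f).coeff n = 0 := by
  rw [coeff_iterate_deriv, hf _ (by omega), mul_zero]

theorem coeff_mul_eq_zero_of_lt {a g : LaurentSeries C} {s t : ℤ} (ha : ∀ n < s, a.coeff n = 0)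
    (hg : ∀ n < t, g.coeff n = 0) {n : ℤ} (hn : n < s + t) : (a * g).coeff n = 0 := by
  rw [HahnSeries.coeff_mul]
  refine Finset.sum_eq_zero fun ij hij => ?_
  have h := (Finset.mem_antidiagonal.1 hij).2.2
  by_cases h1 : ij.1 < s
  · rw [ha _ h1, zero_mul]
  · rw [hg _ (by omega), mul_zero]

theorem coeff_mul_add {a g : LaurentSeries C} {s t : ℤ} (ha : ∀ n < s, a.coeff n = 0)
    (hg : ∀ n < t, g.coeff n = 0) : (a * g).coeff (s + t) = a.coeff s * g.coeff t := by
  rw [HahnSeries.coeff_mul, Finset.sum_eq_single (s, t)]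
  · intro ij hij hne
    have h := (Finset.mem_antidiagonal.1 hij).2.2
    by_cases h1 : ij.1 < s
    · rw [ha _ h1, zero_mul]
    · rw [hg _ ?_, mul_zero]
      rcases lt_or_eq_of_le (not_lt.1 h1) with h2 | h2
      · omega
      · exact absurd (Prod.ext h2.symm (by omega)) hne
  · intro h
    by_contra h0
    exact h (Finset.mem_antidiagonal.2 ⟨left_ne_zero_of_mul h0, right_ne_zero_of_mul h0, rfl⟩)

/-- The action of an operator with Laurent series coefficients. -/
def laurentAct (A : (LaurentSeries C)[X]) (f : LaurentSeries C) : LaurentSeries C :=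
  A.sum fun i a => a * (Differential.deriv (R := LaurentSeries C))^[i] f

theorem act_eq_laurentAct (L : DiffOp C) (f : LaurentSeries C) :
    act L f = laurentAct (L.map (algebraMap (RatFunc C) (LaurentSeries C))) f := by
  rw [act, laurentAct, Polynomial.sum_over_range L (by simp),
    Polynomial.sum_over_range _ (by simp), natDegree_map]
  exact Finset.sum_congr rfl fun i _ => by rw [coeff_map, Algebra.smul_def]

/-- The polynomial `p` such that `p(s) x^{s+e}` is the term of exponent `s + e` of `A · x^s`. -/
def laurentIndicial (A : (LaurentSeries C)[X]) (e : ℤ) : C[X] :=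
  A.sum fun i a => Polynomial.C (a.coeff (e + i)) * descPochhammer C i

theorem indicialCoeff_eq_laurentIndicial (N : DiffOp C) (e : ℤ) :
    indicialCoeff N e = laurentIndicial (N.map (algebraMap (RatFunc C) (LaurentSeries C))) e := by
  rw [indicialCoeff, laurentIndicial, Polynomial.sum_over_range _ (fun _ => by simp),
    Polynomial.sum_over_range _ (fun _ => by simp), natDegree_map]
  exact Finset.sum_congr rfl fun i _ => by rw [coeff_map]

/-- At the least possible exponent, only the lowest terms of the coefficients and of `f` contribute.
-/
theorem coeff_laurentAct {A : (LaurentSeries C)[X]} {σ : ℤ}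
    (hA : ∀ i, ∀ e < σ, (A.coeff i).coeff (e + i) = 0) {f : LaurentSeries C} {ν : ℤ}
    (hf : ∀ n < ν, f.coeff n = 0) :
    (laurentAct A f).coeff (σ + ν) = (laurentIndicial A σ).eval (ν : C) * f.coeff ν := by
  rw [laurentAct, laurentIndicial, Polynomial.sum_def, Polynomial.sum_def, HahnSeries.coeff_sum,
    eval_finsetSum, Finset.sum_mul]
  refine Finset.sum_congr rfl fun i _ => ?_
  rw [show σ + ν = (σ + i) + (ν - i) by ring, coeff_mul_add (s := σ + i) (t := ν - i)
    (fun n hn => by simpa using hA i (n - i) (by omega))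
    (fun n hn => coeff_iterate_deriv_eq_zero hf i hn), coeff_iterate_deriv, eval_mul, eval_C,
    sub_add_cancel, mul_assoc]

/-- The falling factorials are linearly independent in characteristic zero. Evaluation at `s = i`
gives a triangular system: terms `j > i` vanish, terms `j < i` are zero by induction, and the
diagonal entry is `i!`. -/
theorem laurentIndicial_eq_zero_iff [CharZero C] (A : (LaurentSeries C)[X]) (e : ℤ) :
    laurentIndicial A e = 0 ↔ ∀ i : ℕ, (A.coeff i).coeff (e + i) = 0 := by
  constructor
  · intro h i
    induction i using Nat.strong_induction_on with | _ i ih => ?_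
    have h1 := congrArg (Polynomial.eval (i : C)) h
    rw [laurentIndicial, Polynomial.sum_def, eval_finsetSum, eval_zero,
      Finset.sum_eq_single i] at h1
    · rw [eval_mul, eval_C, descPochhammer_eval_eq_descFactorial, Nat.descFactorial_self] at h1
      exact (mul_eq_zero.1 h1).resolve_right (by exact_mod_cast i.factorial_ne_zero)
    · intro j _ hj
      rw [eval_mul, eval_C]
      rcases lt_or_gt_of_ne hj with hj | hj
      · rw [ih j hj, zero_mul]
      · rw [descPochhammer_eval_eq_descFactorial, Nat.descFactorial_eq_zero_iff_lt.2 hj,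
          Nat.cast_zero, mul_zero]
    · intro hi
      rw [notMem_support_iff.1 hi, HahnSeries.coeff_zero, C_0, zero_mul, eval_zero]
  · intro h
    rw [laurentIndicial, Polynomial.sum_def]
    exact Finset.sum_eq_zero fun i _ => by rw [h, C_0, zero_mul]

theorem exists_laurentIndicial_ne_zero [CharZero C] {A : (LaurentSeries C)[X]} (hA : A ≠ 0) :
    ∃ σ : ℤ, laurentIndicial A σ ≠ 0 ∧ ∀ e < σ, laurentIndicial A e = 0 := by
  -- `x^n Dⁱ` shifts exponents by `n - i`, so no shift below `B` can occur.
  obtain ⟨B, hB⟩ := (A.support.image fun i => (A.coeff i).order - (i : ℤ)).bddBelow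
  have hlow : ∀ e : ℤ, laurentIndicial A e ≠ 0 → B ≤ e := by
    intro e he
    by_contra hlt
    refine he ((laurentIndicial_eq_zero_iff A e).2 fun i => ?_)
    by_cases hi : i ∈ A.support
    · have := hB (Finset.mem_coe.2 (Finset.mem_image_of_mem _ hi))
      exact HahnSeries.coeff_eq_zero_of_lt_order (by omega)
    · rw [notMem_support_iff.1 hi, HahnSeries.coeff_zero]
  have hne : ∃ e : ℤ, laurentIndicial A e ≠ 0 := by
    by_contra! h
    refine hA (Polynomial.ext fun i => ?_)
    ext n
    simpa using (laurentIndicial_eq_zero_iff A (n - i)).1 (h _) i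
  obtain ⟨σ, h1, h2⟩ := Int.exists_least_of_bdd ⟨B, hlow⟩ hne
  exact ⟨σ, h1, fun e he => by_contra fun h => absurd (h2 e h) (not_le.2 he)⟩

theorem natDegree_laurentIndicial_le (A : (LaurentSeries C)[X]) (e : ℤ) :
    (laurentIndicial A e).natDegree ≤ A.natDegree := by
  refine natDegree_sum_le_of_forall_le _ _ fun i hi => (natDegree_C_mul_le _ _).trans ?_
  rw [descPochhammer_natDegree]
  exact le_natDegree_of_mem_supp i hi

/-! ### Finiteness of solution spaces over Laurent series -/

/-- Exponents of solutions are roots of the indicial polynomial. -/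
theorem eval_laurentIndicial_eq_zero [CharZero C] {A : (LaurentSeries C)[X]} {σ : ℤ}
    (hσ : ∀ e < σ, laurentIndicial A e = 0) {f : LaurentSeries C} (hf : laurentAct A f = 0) {ν : ℤ}
    (hν : ∀ n < ν, f.coeff n = 0) (h0 : f.coeff ν ≠ 0) :
    (laurentIndicial A σ).eval (ν : C) = 0 := by
  have h := coeff_laurentAct (A := A) (σ := σ)
    (fun i e he => (laurentIndicial_eq_zero_iff A e).1 (hσ e he) i) hν
  rw [hf, HahnSeries.coeff_zero] at h
  exact (mul_eq_zero.1 h.symm).resolve_right h0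

/-- The order of a nonzero solution is an integer root of the indicial polynomial. Hence a solution
is determined by its coefficients at these roots, and there are at most as many of them as the order
of `A`. -/
theorem finite_and_finrank_le_of_laurentAct_eq_zero [CharZero C] {A : (LaurentSeries C)[X]}
    (hA : A ≠ 0) (U : Submodule C (LaurentSeries C)) (hU : ∀ f ∈ U, laurentAct A f = 0) :
    Module.Finite C U ∧ Module.finrank C U ≤ A.natDegree := by
  classical
  obtain ⟨σ, hσ, hlow⟩ := exists_laurentIndicial_ne_zero hA
  set p := laurentIndicial A σ with hp
  set Z : Finset ℤ := p.roots.toFinset.preimage (fun n : ℤ => (n : C))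
    (Int.cast_injective.injOn) with hZ
  have hcard : Z.card ≤ A.natDegree := by
    refine (Finset.card_le_card_of_injOn (fun n : ℤ => (n : C)) (t := p.roots.toFinset)
      (fun n hn => (Finset.mem_preimage.1 hn)) Int.cast_injective.injOn).trans ?_
    exact (Multiset.toFinset_card_le _).trans
      ((Polynomial.card_roots' p).trans (natDegree_laurentIndicial_le A σ))
  let φ : U →ₗ[C] (Z → C) :=
    { toFun := fun f n => (f : LaurentSeries C).coeff n
      map_add' := fun f g => by ext; simp
      map_smul' := fun c f => by ext; simp }
  have hφ : Function.Injective φ := by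
    rw [← LinearMap.ker_eq_bot, LinearMap.ker_eq_bot']
    intro f hf
    by_contra hne
    have hne' : (f : LaurentSeries C) ≠ 0 := fun h => hne (Subtype.ext h)
    have hord := HahnSeries.coeff_order_eq_zero.not.2 hne'
    have hroot := eval_laurentIndicial_eq_zero hlow (hU f f.2)
      (fun n hn => HahnSeries.coeff_eq_zero_of_lt_order hn) hord
    have hmem : (f : LaurentSeries C).order ∈ Z := by
      rw [hZ, Finset.mem_preimage, Multiset.mem_toFinset, mem_roots hσ]
      exact hroot
    exact hord (congrFun hf ⟨_, hmem⟩)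
  refine ⟨Module.Finite.of_injective φ hφ, ?_⟩
  refine (LinearMap.finrank_le_finrank_of_injective hφ).trans ?_
  rw [Module.finrank_fintype_fun_eq_card, Fintype.card_coe]
  exact hcard

/-- The Wronskian criterion: `r` independent Laurent series satisfy no equation of order
less than `r`. -/
theorem eq_zero_of_sum_mul_iterate_deriv_eq_zero [CharZero C] {r : ℕ} {f : Fin r → LaurentSeries C}
    (hf : LinearIndependent C f) {a : Fin r → LaurentSeries C}
    (h : ∀ b, ∑ i, a i * (Differential.deriv (R := LaurentSeries C))^[i] (f b) = 0) : a = 0 := by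
  set A : (LaurentSeries C)[X] := ∑ i : Fin r, Polynomial.C (a i) * X ^ (i : ℕ) with hAdef
  have hcoeff (i : Fin r) : A.coeff i = a i := by
    rw [hAdef, finsetSum_coeff, Finset.sum_eq_single i]
    · rw [coeff_C_mul_X_pow, if_pos rfl]
    · intro j _ hj
      rw [coeff_C_mul_X_pow, if_neg fun h => hj (Fin.ext h.symm)]
    · simp
  have hdeg : A.degree < r := by
    refine (degree_sum_fin_lt _)
  by_contra hne
  have hA : A ≠ 0 := fun h0 => hne (funext fun i => by rw [← hcoeff, h0, coeff_zero]; rfl)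
  have hact (g : LaurentSeries C) :
      laurentAct A g = ∑ i, a i * (Differential.deriv (R := LaurentSeries C))^[i] g := by
    rw [laurentAct, Polynomial.sum_over_range' A (by simp) r
      ((natDegree_lt_iff_degree_lt hA).2 hdeg), ← Fin.sum_univ_eq_sum_range
      (fun i => A.coeff i * (Differential.deriv (R := LaurentSeries C))^[i] g)]
    exact Finset.sum_congr rfl fun i _ => by rw [hcoeff]
  -- If some `a i` were nonzero, an operator of order below `r` would annihilate the span of `f`,
  -- which has dimension `r`.
  have hle := (finite_and_finrank_le_of_laurentAct_eq_zero hA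
    (Submodule.span C (Set.range f)) (fun g hg => by
      rw [hact]
      induction hg using Submodule.span_induction with
      | mem x hx => obtain ⟨b, rfl⟩ := hx; exact h b
      | zero => simp [iterate_map_zero]
      | add x y _ _ hx hy =>
        simp only [iterate_deriv_add, mul_add, Finset.sum_add_distrib, hx, hy, add_zero]
      | smul c x _ hx =>
        simp only [iterate_deriv_smul, mul_smul_laurentSeries, ← Finset.smul_sum, hx, smul_zero])).2
  rw [finrank_span_eq_card hf, Fintype.card_fin] at hle
  have := (natDegree_lt_iff_degree_lt hA).2 hdeg
  omega

/-! ### Solutions at ordinary points -/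

theorem exists_seq_of_recursion {α : Type*} [Zero α] (G : ℕ → (ℕ → α) → α)
    (hG : ∀ n f g, (∀ m < n, f m = g m) → G n f = G n g) : ∃ f : ℕ → α, ∀ n, f n = G n f := by
  classical
  let F : ℕ → α := WellFounded.fix Nat.lt_wfRel.wf
    -- Values not yet defined are filled with `0`; by `hG` they do not matter.
    fun n ih => G n fun m => if h : m < n then ih m h else 0
  refine ⟨F, fun n => ?_⟩
  have h := WellFounded.fix_eq Nat.lt_wfRel.wf
    (fun n (ih : ∀ m, m < n → α) => G n fun m => if h : m < n then ih m h else 0) n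
  exact h.trans (hG n _ _ fun m hm => dif_pos hm)

/-- The `i`-th derivative of a power series. -/
def psDeriv (i : ℕ) (f : ℕ → C) : PowerSeries C :=
  PowerSeries.mk fun k => (descPochhammer C i).eval ((k + i : ℕ) : C) * f (k + i)

theorem iterate_deriv_coe_mk (f : ℕ → C) (i : ℕ) :
    (Differential.deriv (R := LaurentSeries C))^[i]
      ((PowerSeries.mk f : PowerSeries C) : LaurentSeries C) =
        ((psDeriv i f : PowerSeries C) : LaurentSeries C) := by
  ext n
  rw [coeff_iterate_deriv, PowerSeries.coeff_coe, PowerSeries.coeff_coe]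
  split_ifs with h1 h2 h2
  · rw [mul_zero]
  · omega
  -- Here `0 ≤ n + i < i`, so the falling factorial vanishes: derivatives of power series have no
  -- negative exponents.
  · obtain ⟨m, hm⟩ := Int.eq_ofNat_of_zero_le (show 0 ≤ n + i by omega)
    rw [hm, Int.cast_natCast, descPochhammer_eval_eq_descFactorial,
      Nat.descFactorial_eq_zero_iff_lt.2 (by omega), Nat.cast_zero, zero_mul]
  · obtain ⟨m, rfl⟩ := Int.eq_ofNat_of_zero_le (show 0 ≤ n by omega)
    rw [psDeriv, PowerSeries.coeff_mk, PowerSeries.coeff_mk]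
    have e : ((m : ℤ) + i).natAbs = m + i := by omega
    simp only [e, Int.natAbs_natCast]
    push_cast
    rfl

/-- After division by the leading coefficient, the coefficients of `N` are power series. -/
def IsRegularAtZero (N : DiffOp C) : Prop :=
  ∀ i, ∃ a : PowerSeries C, algebraMap (RatFunc C) (LaurentSeries C)
    (N.coeff i / N.leadingCoeff) = (a : LaurentSeries C)

theorem mem_solutionSpace (L : DiffOp C) (f : LaurentSeries C) :
    f ∈ solutionSpace L ↔ act L f = 0 := Iff.rfl

/-- Comparing coefficients of `x^(n-r)` in the monic equation expresses the `n`-th coefficient of a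
solution by earlier ones, because the falling factorial `n(n-1)⋯(n-r+1)` is invertible for `n ≥ r`.
The first `r` coefficients are free. -/
theorem exists_powerSeries_solution [CharZero C] {N : DiffOp C} (hN : N ≠ 0)
    (hreg : IsRegularAtZero N) (c : ℕ → C) :
    ∃ f : PowerSeries C, (f : LaurentSeries C) ∈ solutionSpace N ∧
      ∀ i < N.natDegree, PowerSeries.coeff i f = c i := by
  choose a ha using hreg
  set r := N.natDegree with hr
  obtain ⟨f, hf⟩ := exists_seq_of_recursion (fun n f => if n < r then c n else
    -((descPochhammer C r).eval (n : C))⁻¹ * ∑ i ∈ Finset.range r,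
      ∑ p ∈ Finset.HasAntidiagonal.antidiagonal (n - r), PowerSeries.coeff p.1 (a i) *
        ((descPochhammer C i).eval ((p.2 + i : ℕ) : C) * f (p.2 + i))) (by
      intro n f g h
      split_ifs with hn
      · rfl
      congr 1
      refine Finset.sum_congr rfl fun i hi => Finset.sum_congr rfl fun p hp => ?_
      have h1 := Finset.mem_range.1 hi
      have h2 := Finset.HasAntidiagonal.mem_antidiagonal.1 hp
      rw [h _ (by omega)])
  refine ⟨PowerSeries.mk f, ?_, fun i hi => ?_⟩
  · have key : psDeriv r f + ∑ i ∈ Finset.range r, a i * psDeriv i f = 0 := by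
      ext m
      have hm := hf (m + r)
      rw [if_neg (by omega), Nat.add_sub_cancel] at hm
      have h0 : (descPochhammer C r).eval ((m + r : ℕ) : C) ≠ 0 := by
        rw [descPochhammer_eval_eq_descFactorial]
        exact_mod_cast (Nat.descFactorial_pos.2 (by omega)).ne'
      rw [map_add, map_sum, map_zero, psDeriv, PowerSeries.coeff_mk, hm, ← mul_assoc,
        mul_neg, mul_inv_cancel₀ h0, neg_one_mul, neg_add_eq_zero]
      refine Finset.sum_congr rfl fun i _ => ?_
      rw [PowerSeries.coeff_mul]
      refine Finset.sum_congr rfl fun p _ => ?_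
      rw [psDeriv, PowerSeries.coeff_mk]
    have hlc : N.leadingCoeff ≠ 0 := leadingCoeff_ne_zero.2 hN
    have hact : act (Polynomial.C N.leadingCoeff⁻¹ * N)
        ((PowerSeries.mk f : PowerSeries C) : LaurentSeries C) = 0 := by
      rw [act, Polynomial.sum_over_range' _ (by simp) (r + 1)
        (Nat.lt_succ_of_le (natDegree_C_mul_le _ _)), Finset.sum_range_succ]
      simp only [coeff_C_mul, iterate_deriv_coe_mk, Algebra.smul_def]
      rw [hr, coeff_natDegree, inv_mul_cancel₀ hlc, map_one, one_mul]
      have h2 (i : ℕ) : algebraMap (RatFunc C) (LaurentSeries C) (N.leadingCoeff⁻¹ * N.coeff i) =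
          (a i : LaurentSeries C) := by
        rw [← ha, div_eq_inv_mul]
      simp only [h2, ← map_mul, ← map_sum, ← map_add]
      rw [add_comm, key, map_zero]
    rw [act_C_mul] at hact
    exact (smul_eq_zero.1 hact).resolve_left (inv_ne_zero hlc)
  · rw [PowerSeries.coeff_mk, hf, if_pos hi]

/-! ### Dimensions of solution spaces of operators and of their right factors -/

theorem finite_solutionSpace [CharZero C] {N : DiffOp C} (hN : N ≠ 0) :
    Module.Finite C (solutionSpace N) ∧ Module.finrank C (solutionSpace N) ≤ N.natDegree := by
  have := finite_and_finrank_le_of_laurentAct_eq_zero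
    (A := N.map (algebraMap (RatFunc C) (LaurentSeries C)))
    ((Polynomial.map_ne_zero_iff (algebraMap (RatFunc C) (LaurentSeries C)).injective).2 hN)
    (solutionSpace N) (fun f hf => by rw [← act_eq_laurentAct]; exact hf)
  rwa [natDegree_map] at this

theorem finrank_solutionSpace_of_regular [CharZero C] {N : DiffOp C} (hN : N ≠ 0)
    (hreg : IsRegularAtZero N) : Module.finrank C (solutionSpace N) = N.natDegree := by
  obtain ⟨hfin, hle⟩ := finite_solutionSpace hN
  refine hle.antisymm ?_
  let φ : solutionSpace N →ₗ[C] (Fin N.natDegree → C) :=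
    { toFun := fun f n => (f : LaurentSeries C).coeff n
      map_add' := fun f g => by ext; simp
      map_smul' := fun c f => by ext; simp }
  have hφ : Function.Surjective φ := by
    intro c
    obtain ⟨f, hf, hc⟩ := exists_powerSeries_solution hN hreg
      (fun n => if h : n < N.natDegree then c ⟨n, h⟩ else 0)
    refine ⟨⟨f, hf⟩, funext fun i => ?_⟩
    change (f : LaurentSeries C).coeff (i : ℕ) = c i
    rw [LaurentSeries.coeff_coe_powerSeries, hc i i.2, dif_pos i.2]
  have := LinearMap.finrank_le_finrank_of_surjective hφ
  simpa using this

/-- The action of an operator as a linear map. -/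
def actLinear (L : DiffOp C) : LaurentSeries C →ₗ[C] LaurentSeries C where
  toFun := act L
  map_add' := act_add_right L
  map_smul' c f := by
    rw [act_eq_laurentAct, act_eq_laurentAct, laurentAct, laurentAct, Polynomial.sum_def,
      Polynomial.sum_def, RingHom.id_apply, Finset.smul_sum]
    simp only [iterate_deriv_smul, mul_smul_laurentSeries]

/-- A right factor of an operator with a full solution space has a full solution space. -/
theorem finrank_solutionSpace_of_oreMul [CharZero C] {A B : DiffOp C} (hA : A ≠ 0) (hB : B ≠ 0)
    (h : Module.finrank C (solutionSpace (oreMul A B)) = (oreMul A B).natDegree) :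
    Module.finrank C (solutionSpace B) = B.natDegree := by
  obtain ⟨_, hleA⟩ := finite_solutionSpace hA
  obtain ⟨_, hleB⟩ := finite_solutionSpace hB
  obtain ⟨_, -⟩ := finite_solutionSpace (oreMul_ne_zero hA hB)
  rw [natDegree_oreMul hA hB] at h
  have hmaps : ∀ f ∈ solutionSpace (oreMul A B), actLinear B f ∈ solutionSpace A := by
    intro f hf
    rw [mem_solutionSpace, act_oreMul] at hf
    exact hf
  have hker : Module.finrank C (LinearMap.ker ((actLinear B).restrict hmaps)) ≤
      Module.finrank C (solutionSpace B) := by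
    rw [LinearMap.ker_restrict, ← Submodule.finrank_map_subtype_eq, Submodule.map_comap_subtype]
    exact Submodule.finrank_mono fun f hf => hf.2
  -- `B` maps `V(AB)` to `V(A)` with kernel inside `V(B)`. As `dim V(AB) = ord A + ord B` and
  -- neither `dim V(A)` nor `dim V(B)` exceeds the order, both bounds are attained.
  have h1 := LinearMap.finrank_range_add_finrank_ker ((actLinear B).restrict hmaps)
  have h2 := Submodule.finrank_le (LinearMap.range ((actLinear B).restrict hmaps))
  omega

/-! ### Primitive operators -/

theorem IsPrimitiveOp.ne_zero {Q : DiffOp C} (h : IsPrimitiveOp Q) : Q ≠ 0 := by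
  obtain ⟨q, rfl, hq, -⟩ := h
  exact (Polynomial.map_ne_zero_iff (RatFunc.algebraMap_injective C)).2 hq.ne_zero

theorem isPrimitive_C_mul {u : C} (hu : u ≠ 0) {p : C[X][X]} (hp : p.IsPrimitive) :
    (Polynomial.C (Polynomial.C u) * p).IsPrimitive := by
  intro r hr
  refine hp r ((IsUnit.dvd_mul_left ?_).1 hr)
  exact isUnit_C.2 (isUnit_C.2 (isUnit_iff_ne_zero.2 hu))

/-- Every nonzero operator has a primitive multiple by a rational function. -/
theorem exists_isPrimitiveOp_C_mul {P : DiffOp C} (hP : P ≠ 0) :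
    ∃ a : RatFunc C, a ≠ 0 ∧ IsPrimitiveOp (Polynomial.C a * P) := by
  classical
  let : NormalizedGCDMonoid C[X] := Classical.choice inferInstance
  obtain ⟨b, hb, h⟩ := IsLocalization.integerNormalization_spec (nonZeroDivisors C[X]) P
  set p := IsLocalization.integerNormalization (nonZeroDivisors C[X]) P
  have hb0 : algebraMap C[X] (RatFunc C) b ≠ 0 :=
    RatFunc.algebraMap_ne_zero (nonZeroDivisors.ne_zero hb)
  have hsmul : b • P = Polynomial.C (algebraMap C[X] (RatFunc C) b) * P := by
    ext1 i
    rw [coeff_smul, coeff_C_mul, Algebra.smul_def]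
  rw [hsmul] at h
  have hp : p ≠ 0 := by
    intro hp
    rw [hp, Polynomial.map_zero] at h
    exact mul_ne_zero (C_ne_zero.2 hb0) hP h.symm
  have hc : algebraMap C[X] (RatFunc C) p.content ≠ 0 :=
    RatFunc.algebraMap_ne_zero (mt content_eq_zero_iff.1 hp)
  have hcp := congrArg (Polynomial.map (algebraMap C[X] (RatFunc C))) p.eq_C_content_mul_primPart
  rw [Polynomial.map_mul, map_C] at hcp
  -- The primitive part is determined up to a constant; dividing by `u` makes its leading
  -- coefficient monic.
  set u : C := p.primPart.leadingCoeff.leadingCoeff with hu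
  have hu0 : u ≠ 0 := leadingCoeff_ne_zero.2 (leadingCoeff_ne_zero.2 p.primPart_ne_zero)
  refine ⟨algebraMap C[X] (RatFunc C) (Polynomial.C u⁻¹) *
    ((algebraMap C[X] (RatFunc C) p.content)⁻¹ * algebraMap C[X] (RatFunc C) b), ?_,
    Polynomial.C (Polynomial.C u⁻¹) * p.primPart, ?_,
    isPrimitive_C_mul (inv_ne_zero hu0) p.isPrimitive_primPart, ?_⟩
  · exact mul_ne_zero (RatFunc.algebraMap_ne_zero (C_ne_zero.2 (inv_ne_zero hu0)))
      (mul_ne_zero (inv_ne_zero hc) hb0)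
  · rw [Polynomial.map_mul, map_C, C_mul, C_mul, mul_assoc, mul_assoc, ← h, hcp,
      ← mul_assoc (Polynomial.C _⁻¹), ← C_mul, inv_mul_cancel₀ hc, C_1, one_mul]
  · rw [leadingCoeff_mul, leadingCoeff_C]
    exact monic_C_mul_of_mul_leadingCoeff_eq_one (inv_mul_cancel₀ hu0)

/-- By Gauss's lemma the two primitive polynomials divide each other, so they differ by a constant
of `C`, and monic leading coefficients force it to be `1`. -/
theorem IsPrimitiveOp.eq_of_C_mul {P Q : DiffOp C} (hP : IsPrimitiveOp P) (hQ : IsPrimitiveOp Q)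
    {a : RatFunc C} (ha : a ≠ 0) (h : P = Polynomial.C a * Q) : P = Q := by
  classical
  let : NormalizedGCDMonoid C[X] := Classical.choice inferInstance
  obtain ⟨p, rfl, hp, hpm⟩ := hP
  obtain ⟨q, rfl, hq, hqm⟩ := hQ
  have h1 : q ∣ p := hq.dvd_of_fraction_map_dvd_fraction_map (K := RatFunc C)
    ⟨Polynomial.C a, by rw [h, mul_comm]⟩
  have h2 : p ∣ q := hp.dvd_of_fraction_map_dvd_fraction_map (K := RatFunc C)
    ⟨Polynomial.C a⁻¹, by
      rw [h, mul_right_comm, ← C_mul, mul_inv_cancel₀ ha, C_1, one_mul]⟩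
  obtain ⟨v, hv⟩ := associated_of_dvd_dvd h1 h2
  obtain ⟨w, hw, hwv⟩ := isUnit_iff.1 v.isUnit
  obtain ⟨c, hc, hcw⟩ := isUnit_iff.1 hw
  rw [← hwv, ← hcw] at hv
  have h3 := congrArg leadingCoeff (congrArg leadingCoeff hv)
  rw [leadingCoeff_mul, leadingCoeff_mul, leadingCoeff_C, leadingCoeff_C, hqm.leadingCoeff,
    hpm.leadingCoeff, one_mul] at h3
  rw [← hv, h3, C_1, C_1, mul_one]

/-! ### Symmetric products -/

theorem iterate_deriv_mul {F : Type*} [CommRing F] [Differential F] (n : ℕ) (f g : F) :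
    (Differential.deriv (R := F))^[n] (f * g) =
      ∑ p ∈ Finset.HasAntidiagonal.antidiagonal n, n.choose p.1 •
        ((Differential.deriv (R := F))^[p.1] f * (Differential.deriv (R := F))^[p.2] g) := by
  induction n with
  | zero => simp
  | succ n ih =>
    rw [Finset.sum_antidiagonal_choose_succ_nsmul (fun i j =>
      (Differential.deriv (R := F))^[i] f * (Differential.deriv (R := F))^[j] g) n]
    simp only [Function.iterate_succ_apply', ih, map_sum, map_nsmul, differential_leibniz, smul_add,
      Finset.sum_add_distrib, add_right_inj]
    refine Finset.sum_congr rfl fun p hp => ?_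
    rw [n.choose_symm_of_eq_add (Finset.HasAntidiagonal.mem_antidiagonal.1 hp).symm, mul_comm]

/-- Higher derivatives of a solution are combinations of the first ones, with coefficients that
depend on the operator only. -/
theorem exists_iterate_deriv_eq_sum {L : DiffOp C} (hL : L ≠ 0) (k : ℕ) :
    ∃ ρ : Fin L.natDegree → RatFunc C, ∀ (F : Type u) [CommRing F] [Differential F]
      [Algebra (RatFunc C) F] [DifferentialAlgebra (RatFunc C) F] (f : F), act L f = 0 →
        (Differential.deriv (R := F))^[k] f =
          ∑ i, ρ i • (Differential.deriv (R := F))^[i] f := by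
  -- On solutions of `L`, the operator `Dᵏ` acts as its remainder modulo `L`.
  obtain ⟨A, R, h, hR⟩ := exists_oreMul_add_eq hL (X ^ k)
  refine ⟨fun i => R.coeff i, fun F _ _ _ _ f hf => ?_⟩
  rw [← act_X_pow (C := C), h, act_add, act_oreMul, hf, act_zero_right, zero_add]
  exact act_eq_sum_fin R (hR.trans_eq (degree_eq_natDegree hL)) f

theorem exists_iterate_deriv_mul_eq_sum {L Q : DiffOp C} (hL : L ≠ 0) (hQ : Q ≠ 0) (n : ℕ) :
    ∃ c : Fin L.natDegree → Fin Q.natDegree → RatFunc C, ∀ (F : Type u) [CommRing F]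
      [Differential F] [Algebra (RatFunc C) F] [DifferentialAlgebra (RatFunc C) F] (f g : F),
        act L f = 0 → act Q g = 0 → (Differential.deriv (R := F))^[n] (f * g) =
          ∑ i, ∑ j, c i j • ((Differential.deriv (R := F))^[i] f *
            (Differential.deriv (R := F))^[j] g) := by
  choose ρ hρ using exists_iterate_deriv_eq_sum hL
  choose τ hτ using exists_iterate_deriv_eq_sum hQ
  refine ⟨fun i j => ∑ p ∈ Finset.HasAntidiagonal.antidiagonal n,
    n.choose p.1 • (ρ p.1 i * τ p.2 j), fun F _ _ _ _ f g hf hg => ?_⟩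
  rw [iterate_deriv_mul]
  simp only [Finset.sum_smul]
  simp_rw [Finset.sum_comm (t := Finset.HasAntidiagonal.antidiagonal n)]
  refine Finset.sum_congr rfl fun p _ => ?_
  rw [hρ p.1 F f hf, hτ p.2 F g hg, Finset.sum_mul_sum, Finset.smul_sum]
  refine Finset.sum_congr rfl fun i _ => ?_
  rw [Finset.smul_sum]
  refine Finset.sum_congr rfl fun j _ => ?_
  rw [smul_mul_smul_comm, smul_assoc]

/-- The coefficients `c` are chosen before the ring `F`. If they vanish, `M` annihilates products in
every differential extension, so one ring with enough solutions suffices to show it. -/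
theorem exists_act_mul_eq_sum {L Q : DiffOp C} (hL : L ≠ 0) (hQ : Q ≠ 0) (M : DiffOp C) :
    ∃ c : Fin L.natDegree → Fin Q.natDegree → RatFunc C, ∀ (F : Type u) [CommRing F]
      [Differential F] [Algebra (RatFunc C) F] [DifferentialAlgebra (RatFunc C) F] (f g : F),
        act L f = 0 → act Q g = 0 → act M (f * g) =
          ∑ i, ∑ j, c i j • ((Differential.deriv (R := F))^[i] f *
            (Differential.deriv (R := F))^[j] g) := by
  choose c hc using exists_iterate_deriv_mul_eq_sum hL hQ
  refine ⟨fun i j => ∑ n ∈ M.support, M.coeff n * c n i j, fun F _ _ _ _ f g hf hg => ?_⟩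
  simp only [Finset.sum_smul]
  simp_rw [Finset.sum_comm (t := M.support)]
  rw [act, Polynomial.sum_def]
  refine Finset.sum_congr rfl fun n _ => ?_
  rw [hc n F f g hf hg, Finset.smul_sum]
  refine Finset.sum_congr rfl fun i _ => ?_
  rw [Finset.smul_sum]
  exact Finset.sum_congr rfl fun j _ => by rw [mul_smul]

/-- The Wronskian criterion is applied twice: for fixed `k` to the `g l`, with Laurent series
coefficients `∑ i, c i j • (f k)⁽ⁱ⁾`, and then for fixed `j` to the `f k`. -/
theorem eq_zero_of_sum_smul_mul_eq_zero [CharZero C] {r q : ℕ} {f : Fin r → LaurentSeries C}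
    {g : Fin q → LaurentSeries C} (hf : LinearIndependent C f) (hg : LinearIndependent C g)
    {c : Fin r → Fin q → RatFunc C}
    (h : ∀ k l, ∑ i, ∑ j, c i j • ((Differential.deriv (R := LaurentSeries C))^[i] (f k) *
      (Differential.deriv (R := LaurentSeries C))^[j] (g l)) = 0) : c = 0 := by
  have h1 (k : Fin r) : (fun j => ∑ i, c i j •
      (Differential.deriv (R := LaurentSeries C))^[i] (f k)) = 0 := by
    refine eq_zero_of_sum_mul_iterate_deriv_eq_zero hg fun l => ?_
    rw [← h k l, Finset.sum_comm]
    simp only [Finset.sum_mul, smul_mul_assoc]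
  funext i j
  have h2 := eq_zero_of_sum_mul_iterate_deriv_eq_zero
    (a := fun i => algebraMap (RatFunc C) (LaurentSeries C) (c i j)) hf (fun k => by
      simpa only [Algebra.smul_def, Pi.zero_apply] using congrFun (h1 k) j)
  exact (algebraMap (RatFunc C) (LaurentSeries C)).injective
    ((congrFun h2 i).trans (map_zero _).symm)

theorem exists_linearIndependent_of_finrank_eq {E : Type*} [AddCommGroup E] [Module C E]
    {U : Submodule C E} [Module.Finite C U] {n : ℕ} (h : Module.finrank C U = n) :
    ∃ f : Fin n → E, LinearIndependent C f ∧ ∀ i, f i ∈ U := by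
  let b := Module.finBasisOfFinrankEq C U h
  exact ⟨fun i => b i, b.linearIndependent.map' U.subtype U.ker_subtype, fun i => (b i).2⟩

/-- If two operators have full spaces of solutions in `C((x))`, then an operator that annihilates
the products of these solutions annihilates all products of solutions. -/
theorem annihilatesProducts_of_finrank [CharZero C] {L Q M : DiffOp C} (hL : L ≠ 0) (hQ : Q ≠ 0)
    (hLf : Module.finrank C (solutionSpace L) = L.natDegree)
    (hQf : Module.finrank C (solutionSpace Q) = Q.natDegree)
    (h : ∀ f ∈ solutionSpace L, ∀ g ∈ solutionSpace Q, f * g ∈ solutionSpace M) :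
    AnnihilatesProducts L Q M := by
  obtain ⟨c, hc⟩ := exists_act_mul_eq_sum hL hQ M
  obtain ⟨_, -⟩ := finite_solutionSpace hL
  obtain ⟨_, -⟩ := finite_solutionSpace hQ
  obtain ⟨b, hb, hbL⟩ := exists_linearIndependent_of_finrank_eq hLf
  obtain ⟨d, hd, hdQ⟩ := exists_linearIndependent_of_finrank_eq hQf
  have h0 : c = 0 := eq_zero_of_sum_smul_mul_eq_zero hb hd fun k l => by
    rw [← hc (LaurentSeries C) _ _ (hbL k) (hdQ l)]
    exact h _ (hbL k) _ (hdQ l)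
  intro F _ _ _ _ f g hf hg
  rw [hc F f g hf hg, h0]
  simp

theorem AnnihilatesProducts.oreMul {L Q P : DiffOp C} (h : AnnihilatesProducts L Q P)
    (A : DiffOp C) : AnnihilatesProducts L Q (oreMul A P) := by
  intro F _ _ _ _ f g hf hg
  rw [act_oreMul, h F f g hf hg, act_zero_right]

/-- The derivatives of `f g` of order up to `ord L * ord Q` have coefficient tables in a
`C(x)`-space of dimension `ord L * ord Q`. A linear relation between these tables is the required
operator. -/
theorem exists_annihilatesProducts {L Q : DiffOp C} (hL : L ≠ 0) (hQ : Q ≠ 0) :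
    ∃ P : DiffOp C, P ≠ 0 ∧ AnnihilatesProducts L Q P := by
  choose c hc using exists_iterate_deriv_mul_eq_sum hL hQ
  have hdep : ¬ LinearIndependent (RatFunc C)
      (fun n : Fin (L.natDegree * Q.natDegree + 1) => c n) := by
    intro h
    have := h.fintype_card_le_finrank
    simp [Module.finrank_pi_fintype] at this
  obtain ⟨m, hm, i, hi⟩ := Fintype.not_linearIndependent_iff.1 hdep
  refine ⟨∑ n, Polynomial.C (m n) * X ^ (n : ℕ), fun h0 => hi ?_, fun F _ _ _ _ f g hf hg => ?_⟩
  · have := congrArg (fun p => coeff p i) h0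
    rw [finsetSum_coeff, Finset.sum_eq_single i, coeff_C_mul_X_pow, if_pos rfl] at this
    · exact this
    · intro j _ hj
      rw [coeff_C_mul_X_pow, if_neg fun h => hj (Fin.ext h.symm)]
    · simp
  · have e (s : Finset (Fin (L.natDegree * Q.natDegree + 1))) :
        act (∑ n ∈ s, Polynomial.C (m n) * X ^ (n : ℕ)) (f * g) =
          ∑ n ∈ s, m n • (Differential.deriv (R := F))^[n] (f * g) := by
      induction s using Finset.induction_on with
      | empty => simp [act_zero]
      | insert a s ha ih => rw [Finset.sum_insert ha, Finset.sum_insert ha, act_add, ih,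
          act_C_mul_X_pow]
    rw [e]
    have h1 (n : Fin (L.natDegree * Q.natDegree + 1)) :
        m n • (Differential.deriv (R := F))^[n] (f * g) = ∑ i, ∑ j, (m n * c n i j) •
          ((Differential.deriv (R := F))^[i] f * (Differential.deriv (R := F))^[j] g) := by
      rw [hc n F f g hf hg, Finset.smul_sum]
      refine Finset.sum_congr rfl fun i _ => ?_
      rw [Finset.smul_sum]
      exact Finset.sum_congr rfl fun j _ => by rw [mul_smul]
    rw [Finset.sum_congr rfl fun n _ => h1 n, Finset.sum_comm]
    refine Finset.sum_eq_zero fun i _ => ?_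
    rw [Finset.sum_comm]
    refine Finset.sum_eq_zero fun j _ => ?_
    rw [← Finset.sum_smul]
    have h2 := congrFun (congrFun hm i) j
    simp only [Finset.sum_apply, Pi.smul_apply, smul_eq_mul, Pi.zero_apply] at h2
    rw [h2, zero_smul]

theorem exists_isSymProd {L Q : DiffOp C} (hL : L ≠ 0) (hQ : Q ≠ 0) :
    ∃ P, IsSymProd L Q P := by
  classical
  have hex : ∃ n : ℕ, ∃ P : DiffOp C, P ≠ 0 ∧ AnnihilatesProducts L Q P ∧ P.natDegree = n := by
    obtain ⟨P, h0, h⟩ := exists_annihilatesProducts hL hQ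
    exact ⟨_, P, h0, h, rfl⟩
  obtain ⟨P, h0, h, hn⟩ := Nat.find_spec hex
  obtain ⟨a, ha, hp⟩ := exists_isPrimitiveOp_C_mul h0
  refine ⟨Polynomial.C a * P, hp, ?_, fun P' h0' h' => ?_⟩
  · rw [← C_oreMul]
    exact h.oreMul _
  · rw [natDegree_C_mul ha, hn]
    exact Nat.find_min' hex ⟨P', h0', h', rfl⟩

theorem SymProdIsRightFactor.annihilatesProducts {L Q M : DiffOp C}
    (h : SymProdIsRightFactor L Q M) : AnnihilatesProducts L Q M := by
  obtain ⟨P, hP, A, rfl⟩ := h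
  exact hP.2.1.oreMul A

/-- The remainder of `M` modulo the symmetric product also annihilates all products and has smaller
order, so it is zero. Being a left multiple of `L ⊗ Q` is thus the same as annihilating products. -/
theorem AnnihilatesProducts.symProdIsRightFactor {L Q M : DiffOp C} (hL : L ≠ 0) (hQ : Q ≠ 0)
    (h : AnnihilatesProducts L Q M) : SymProdIsRightFactor L Q M := by
  obtain ⟨P, hP⟩ := exists_isSymProd hL hQ
  obtain ⟨A, R, hM, hR⟩ := exists_oreMul_add_eq hP.1.ne_zero M
  refine ⟨P, hP, A, ?_⟩
  suffices h0 : R = 0 by rw [hM, h0, add_zero]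
  by_contra h0
  have hle := hP.2.2 R h0 (fun F _ _ _ _ f g hf hg => by
    have h1 := h F f g hf hg
    rwa [hM, act_add, hP.2.1.oreMul A F f g hf hg, zero_add] at h1)
  exact absurd (natDegree_lt_natDegree h0 hR) (not_lt.2 hle)

theorem exists_isSymPow {L : DiffOp C} (hL : L ≠ 0) (s : ℕ) : ∃ P, IsSymPow L s P ∧ P ≠ 0 := by
  induction s with
  | zero => exact ⟨X, rfl, X_ne_zero⟩
  | succ s ih =>
    obtain ⟨P₀, h₀, hne⟩ := ih
    obtain ⟨P, hP⟩ := exists_isSymProd hne hL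
    exact ⟨P, ⟨P₀, h₀, hP⟩, hP.1.ne_zero⟩

theorem IsSymPow.pow_mem_solutionSpace {L : DiffOp C} {s : ℕ} {P : DiffOp C} (h : IsSymPow L s P)
    {g : LaurentSeries C} (hg : g ∈ solutionSpace L) : g ^ s ∈ solutionSpace P := by
  induction s generalizing P with
  | zero =>
    have h' : P = X := h
    rw [h', mem_solutionSpace, act_X, pow_zero]
    simp
  | succ s ih =>
    obtain ⟨P₀, h₀, hP⟩ := h
    rw [pow_succ]
    exact hP.2.1 (LaurentSeries C) _ _ (ih h₀) hg

/-! ### The substitution `x ↦ x + ξ` -/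

theorem ratShift_div (ξ : C) (p q : C[X]) :
    ratShift ξ (algebraMap C[X] (RatFunc C) p / algebraMap C[X] (RatFunc C) q) =
      algebraMap C[X] (RatFunc C) (taylor ξ p) / algebraMap C[X] (RatFunc C) (taylor ξ q) :=
  RatFunc.map_apply_div (taylorAlgHom ξ)
    (nonZeroDivisors_le_comap_nonZeroDivisors_of_injective _ (taylor_injective ξ)) p q

theorem taylor_derivative (ξ : C) (p : C[X]) :
    taylor ξ (derivative p) = derivative (taylor ξ p) := by
  rw [taylor_apply, taylor_apply, derivative_comp]
  simp

theorem ratShift_deriv (ξ : C) (f : RatFunc C) :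
    ratShift ξ (Differential.deriv f) = Differential.deriv (ratShift ξ f) := by
  induction f using RatFunc.induction_on with | f p q hq => ?_
  rw [ratShift_div]
  have e : taylor ξ q ≠ 0 := (taylor_eq_zero ξ q).not.2 hq
  change ratShift ξ (ratDeriv _) = ratDeriv _
  rw [ratDeriv_div _ _ hq, ratDeriv_div _ _ e, ← map_pow, ratShift_div, ← map_pow]
  simp only [map_sub, taylor_mul, taylor_derivative, taylor_pow]

theorem ratShift_algebraMap (ξ : C) (p : C[X]) :
    ratShift ξ (algebraMap C[X] (RatFunc C) p) = algebraMap C[X] (RatFunc C) (taylor ξ p) := by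
  simpa using ratShift_div ξ p 1

theorem ratShift_neg_ratShift (ξ : C) (f : RatFunc C) : ratShift (-ξ) (ratShift ξ f) = f := by
  induction f using RatFunc.induction_on with | f p q hq => ?_
  rw [ratShift_div, ratShift_div, taylor_taylor, taylor_taylor, neg_add_cancel, taylor_zero, taylor_zero]

theorem shift_add (ξ : C) (A B : DiffOp C) : shift ξ (A + B) = shift ξ A + shift ξ B :=
  Polynomial.map_add _

theorem shift_C_mul (ξ : C) (a : RatFunc C) (A : DiffOp C) :
    shift ξ (Polynomial.C a * A) = Polynomial.C (ratShift ξ a) * shift ξ A := by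
  rw [shift, Polynomial.map_mul, map_C, shift]

theorem shift_neg_shift (ξ : C) (A : DiffOp C) : shift (-ξ) (shift ξ A) = A := by
  ext1 i
  rw [shift, coeff_map, shift, coeff_map, ratShift_neg_ratShift]

theorem shift_shift_neg (ξ : C) (A : DiffOp C) : shift ξ (shift (-ξ) A) = A := by
  simpa using shift_neg_shift (-ξ) A

theorem natDegree_shift (ξ : C) (A : DiffOp C) : (shift ξ A).natDegree = A.natDegree :=
  natDegree_map _

theorem leadingCoeff_shift (ξ : C) (A : DiffOp C) :
    (shift ξ A).leadingCoeff = ratShift ξ A.leadingCoeff :=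
  leadingCoeff_map _

theorem shift_ne_zero (ξ : C) {A : DiffOp C} (hA : A ≠ 0) : shift ξ A ≠ 0 :=
  (Polynomial.map_ne_zero_iff (ratShift ξ).injective).2 hA

theorem shift_dMul (ξ : C) (A : DiffOp C) : shift ξ (dMul A) = dMul (shift ξ A) := by
  rw [dMul, dMul, shift_add, shift, Polynomial.map_mul, map_X, ← shift]
  congr 1
  ext1 i
  rw [shift, coeff_map, Differential.coeff_mapCoeffs, Differential.coeff_mapCoeffs, shift,
    coeff_map, ratShift_deriv]

theorem shift_opEval (ξ : C) {T T' : DiffOp C → DiffOp C}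
    (hT : ∀ N, shift ξ (T N) = T' (shift ξ N)) (A N : DiffOp C) :
    shift ξ (opEval T A N) = opEval T' (shift ξ A) (shift ξ N) := by
  have key (n : ℕ) : shift ξ (T^[n] N) = T'^[n] (shift ξ N) := by
    induction n with
    | zero => rfl
    | succ n ih => rw [Function.iterate_succ_apply', Function.iterate_succ_apply', hT, ih]
  induction A using Polynomial.induction_on' with
  | add p q hp hq => rw [opEval_add, shift_add, shift_add, opEval_add, hp, hq]
  | monomial n a =>
    rw [opEval_monomial, shift_C_mul, key,
      show shift ξ (monomial n a) = monomial n (ratShift ξ a) from map_monomial _, opEval_monomial]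

theorem shift_oreMul (ξ : C) (A N : DiffOp C) :
    shift ξ (oreMul A N) = oreMul (shift ξ A) (shift ξ N) :=
  shift_opEval ξ (shift_dMul ξ) A N

theorem shift_expShift (ξ : C) (u : RatFunc C) (M : DiffOp C) :
    shift ξ (expShift u M) = expShift (ratShift ξ u) (shift ξ M) := by
  rw [expShift, shift_opEval (T' := fun N => dMul N + Polynomial.C (ratShift ξ u) * N) ξ
    (fun N => by rw [shift_add, shift_dMul, shift_C_mul]), expShift]
  congr 1
  exact Polynomial.map_one _

theorem IsRightFactor.shift {A B : DiffOp C} (h : IsRightFactor A B) (ξ : C) :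
    IsRightFactor (shift ξ A) (shift ξ B) := by
  obtain ⟨E, rfl⟩ := h
  exact ⟨_, shift_oreMul ξ E A⟩

theorem AnnihilatesProducts.shift {L Q M : DiffOp C} (h : AnnihilatesProducts L Q M) (ξ : C) :
    AnnihilatesProducts (shift ξ L) (shift ξ Q) (shift ξ M) := by
  intro F _ _ alg dalg f g hf hg
  have key (A : DiffOp C) (k : F) :
      act (SymmetricDivision.shift ξ A) k =
        @act C _ F _ _ ((algebraMap (RatFunc C) F).comp (ratShift ξ)).toAlgebra A k := by
    unfold act
    rw [Polynomial.sum_def, Polynomial.sum_def, SymmetricDivision.shift,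
      support_map_of_injective _ (ratShift ξ).injective]
    refine Finset.sum_congr rfl fun i _ => ?_
    rw [coeff_map]
    exact Algebra.smul_def (ratShift ξ (A.coeff i)) ((Differential.deriv (R := F))^[i] k)
  rw [key] at hf hg ⊢
  -- The same ring `F` becomes a `C(x)`-algebra through the shift; the derivation stays compatible
  -- because shifting commutes with `d/dx`. Shifted operators act as the original ones do in the new
  -- structure.
  let := ((algebraMap (RatFunc C) F).comp (ratShift ξ)).toAlgebra
  have : DifferentialAlgebra (RatFunc C) F := ⟨fun a => by
    change Differential.deriv (@algebraMap _ _ _ _ alg (ratShift ξ a)) =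
      @algebraMap _ _ _ _ alg (ratShift ξ (Differential.deriv a))
    rw [@DifferentialAlgebra.deriv_algebraMap _ _ _ _ alg _ _ dalg, ratShift_deriv]⟩
  exact h F f g hf hg

/-- A common divisor of the shifted coefficients can be shifted back to one of the original
coefficients. -/
theorem isPrimitive_map_taylor (ξ : C) {q : C[X][X]} (hq : q.IsPrimitive) :
    (q.map (taylorAlgHom ξ : C[X] →+* C[X])).IsPrimitive := by
  intro r hr
  have h : Polynomial.C (taylor (-ξ) r) ∣ q := by
    obtain ⟨s, hs⟩ := hr
    refine ⟨s.map (taylorAlgHom (-ξ) : C[X] →+* C[X]), ?_⟩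
    have h1 := congrArg (Polynomial.map (taylorAlgHom (-ξ) : C[X] →+* C[X])) hs
    rw [Polynomial.map_map, Polynomial.map_mul, map_C] at h1
    rw [show (Polynomial.C (taylor (-ξ) r)) = Polynomial.C ((taylorAlgHom (-ξ) : C[X] →+* C[X]) r)
      from rfl, ← h1]
    ext1 i
    rw [coeff_map]
    simp [taylor_taylor]
  have h2 := (hq _ h).map (taylorAlgHom ξ)
  simpa [taylor_taylor] using h2

theorem IsPrimitiveOp.shift {Q : DiffOp C} (h : IsPrimitiveOp Q) (ξ : C) :
    IsPrimitiveOp (shift ξ Q) := by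
  obtain ⟨q, rfl, hq, hm⟩ := h
  refine ⟨q.map (taylorAlgHom ξ : C[X] →+* C[X]), ?_, isPrimitive_map_taylor ξ hq, ?_⟩
  · rw [SymmetricDivision.shift, Polynomial.map_map, Polynomial.map_map]
    congr 1
    refine RingHom.ext fun p => ?_
    exact (ratShift_algebraMap ξ p).symm
  · rw [leadingCoeff_map_of_injective (taylor_injective ξ)]
    exact (leadingCoeff_taylor ξ _).trans hm

/-! ### Ordinary points -/

theorem exists_powerSeries_eq_div {p q : C[X]} (hq : q.eval 0 ≠ 0) :
    ∃ a : PowerSeries C, algebraMap (RatFunc C) (LaurentSeries C)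
      (algebraMap C[X] (RatFunc C) p / algebraMap C[X] (RatFunc C) q) = (a : LaurentSeries C) := by
  have hq0 : PowerSeries.constantCoeff (q : PowerSeries C) ≠ 0 := by
    rwa [Polynomial.constantCoeff_coe, coeff_zero_eq_eval_zero]
  have hq1 : q ≠ 0 := by
    rintro rfl
    simp at hq
  have e : ∀ a b : C[X], algebraMap (RatFunc C) (LaurentSeries C)
      (algebraMap C[X] (RatFunc C) a / algebraMap C[X] (RatFunc C) b) =
      algebraMap C[X] (LaurentSeries C) a / algebraMap C[X] (LaurentSeries C) b :=
    fun a b => RatFunc.algebraMap_apply_div a b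
  have hq' : algebraMap C[X] (LaurentSeries C) q ≠ 0 := by
    rw [Ne, Polynomial.algebraMap_hahnSeries_injective ℤ |>.eq_iff' (map_zero _)]
    exact hq1
  refine ⟨(p : PowerSeries C) * (q : PowerSeries C)⁻¹, ?_⟩
  rw [e, div_eq_iff hq', Polynomial.algebraMap_hahnSeries_apply,
    Polynomial.algebraMap_hahnSeries_apply, ← map_mul, mul_assoc, PowerSeries.inv_mul_cancel _ hq0,
    mul_one]

theorem IsOrdinaryPoint.isRegularAtZero_shift {ξ : C} {L : DiffOp C} (h : IsOrdinaryPoint ξ L) :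
    IsRegularAtZero (shift ξ L) := by
  intro i
  rw [leadingCoeff_shift, shift, coeff_map, ← map_div₀, ← RatFunc.num_div_denom
    (L.coeff i / L.leadingCoeff), ratShift_div]
  refine exists_powerSeries_eq_div ?_
  rw [taylor_eval, zero_add]
  exact h i

theorem exists_polynomial_isOrdinaryPoint (L : DiffOp C) :
    ∃ p : C[X], p ≠ 0 ∧ ∀ ξ, p.eval ξ ≠ 0 → IsOrdinaryPoint ξ L := by
  refine ⟨∏ i ∈ Finset.range (L.natDegree + 1), (L.coeff i / L.leadingCoeff).denom,
    Finset.prod_ne_zero_iff.2 fun i _ => RatFunc.denom_ne_zero _, fun ξ h i => ?_⟩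
  rw [eval_prod, Finset.prod_ne_zero_iff] at h
  by_cases hi : i ≤ L.natDegree
  · exact h i (Finset.mem_range.2 (Nat.lt_succ_of_le hi))
  · rw [coeff_eq_zero_of_natDegree_lt (not_le.1 hi), zero_div, RatFunc.denom_zero, eval_one]
    exact one_ne_zero

theorem exists_isOrdinaryPoint [Infinite C] (L M N : DiffOp C) :
    ∃ ξ, IsOrdinaryPoint ξ L ∧ IsOrdinaryPoint ξ M ∧ IsOrdinaryPoint ξ N := by
  obtain ⟨p, hp, hL⟩ := exists_polynomial_isOrdinaryPoint L
  obtain ⟨q, hq, hM⟩ := exists_polynomial_isOrdinaryPoint M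
  obtain ⟨s, hs, hN⟩ := exists_polynomial_isOrdinaryPoint N
  obtain ⟨ξ, hξ⟩ : ∃ ξ, (p * q * s).eval ξ ≠ 0 := by
    by_contra! h
    exact mul_ne_zero (mul_ne_zero hp hq) hs (Polynomial.funext fun ξ => by rw [h, eval_zero])
  rw [eval_mul, eval_mul] at hξ
  exact ⟨ξ, hL ξ (left_ne_zero_of_mul (left_ne_zero_of_mul hξ)),
    hM ξ (right_ne_zero_of_mul (left_ne_zero_of_mul hξ)), hN ξ (right_ne_zero_of_mul hξ)⟩

/-! ### Operators with hyperexponential solutions -/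

theorem act_X_sub_C {F : Type*} [CommRing F] [Differential F] [Algebra (RatFunc C) F]
    (u : RatFunc C) (f : F) :
    act (X - Polynomial.C u : DiffOp C) f = Differential.deriv f - u • f := by
  rw [act_sub, act_X, act_C]

theorem solutionSpace_le_of_oreMul (A B : DiffOp C) :
    solutionSpace B ≤ solutionSpace (oreMul A B) := fun f hf => by
  rw [mem_solutionSpace] at hf ⊢
  rw [act_oreMul, hf, act_zero_right]

/-- A first-order right factor of an operator with a full solution space has a one-dimensional
solution space. -/
theorem exists_exponential_mem_solutionSpace [CharZero C] {L : DiffOp C} (hL : L ≠ 0)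
    (hLf : Module.finrank C (solutionSpace L) = L.natDegree) {u : RatFunc C}
    (hu : IsRightFactor (X - Polynomial.C u) L) :
    ∃ e : LaurentSeries C, e ≠ 0 ∧ Differential.deriv e = u • e ∧ e ∈ solutionSpace L := by
  obtain ⟨A, rfl⟩ := hu
  have hA : A ≠ 0 := by
    rintro rfl
    exact hL (zero_oreMul _)
  have h := finrank_solutionSpace_of_oreMul hA (X_sub_C_ne_zero u) hLf
  rw [natDegree_X_sub_C] at h
  obtain ⟨e, he, hne⟩ := Submodule.exists_mem_ne_zero_of_ne_bot
    (p := solutionSpace (X - Polynomial.C u)) (by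
      intro hbot
      rw [hbot, finrank_bot] at h
      exact zero_ne_one h)
  refine ⟨e, hne, ?_, solutionSpace_le_of_oreMul _ _ he⟩
  rw [mem_solutionSpace, act_X_sub_C] at he
  exact sub_eq_zero.1 he

theorem exists_act_eq_smul {F : Type*} [CommRing F] [Differential F] [Algebra (RatFunc C) F]
    [DifferentialAlgebra (RatFunc C) F] {u : RatFunc C} {e : F}
    (he : Differential.deriv e = u • e) (L : DiffOp C) : ∃ ρ : RatFunc C, act L e = ρ • e := by
  have key (n : ℕ) : ∃ ρ : RatFunc C, (Differential.deriv (R := F))^[n] e = ρ • e := by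
    induction n with
    | zero => exact ⟨1, by simp⟩
    | succ n ih =>
      obtain ⟨ρ, h⟩ := ih
      refine ⟨ρ * u + Differential.deriv ρ, ?_⟩
      rw [Function.iterate_succ_apply', h, deriv_smul, he, add_smul, mul_smul]
  induction L using Polynomial.induction_on' with
  | add p q hp hq =>
    obtain ⟨ρ, h1⟩ := hp
    obtain ⟨τ, h2⟩ := hq
    exact ⟨ρ + τ, by rw [act_add, h1, h2, add_smul]⟩
  | monomial n a =>
    obtain ⟨ρ, h⟩ := key n
    exact ⟨a * ρ, by rw [← C_mul_X_pow_eq_monomial, act_C_mul_X_pow, h, mul_smul]⟩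

/-- Exponentials are annihilated by an operator whose order is at most the dimension of
their span. -/
theorem exists_op_of_exponentials {ι : Type*} [DecidableEq ι]
    {u : ι → RatFunc C} {e : ι → LaurentSeries C}
    (he : ∀ i, Differential.deriv (e i) = u i • e i) (s : Finset ι) :
    ∃ N : DiffOp C, N ≠ 0 ∧ N.natDegree ≤ Module.finrank C (Submodule.span C (e '' s)) ∧
      ∀ i ∈ s, e i ∈ solutionSpace N := by
  induction s using Finset.induction_on with
  | empty => exact ⟨1, one_ne_zero, by simp, by simp⟩
  | insert i s hi ih =>
    obtain ⟨N, hN, hdeg, hs⟩ := ih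
    have hle : Submodule.span C (e '' s) ≤ Submodule.span C (e '' (insert i s : Finset ι)) :=
      Submodule.span_mono (Set.image_mono (by simp))
    have : Module.Finite C (Submodule.span C (e '' (insert i s : Finset ι))) :=
      Module.Finite.span_of_finite C ((Finset.finite_toSet _).image e)
    by_cases h0 : e i ∈ solutionSpace N
    · refine ⟨N, hN, hdeg.trans (Submodule.finrank_mono hle), fun j hj => ?_⟩
      rcases Finset.mem_insert.1 hj with rfl | hj
      exacts [h0, hs j hj]
    obtain ⟨ρ, hρ⟩ := exists_act_eq_smul (he i) N
    have hρ0 : ρ ≠ 0 := by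
      rintro rfl
      exact h0 (by rw [mem_solutionSpace, hρ, zero_smul])
    -- `N · eᵢ = ρ eᵢ` is again an exponential, with logarithmic derivative `uᵢ + ρ'/ρ`; the new
    -- left factor annihilates it.
    refine ⟨oreMul (X - Polynomial.C (u i + Differential.deriv ρ / ρ)) N,
      oreMul_ne_zero (X_sub_C_ne_zero _) hN, ?_, fun j hj => ?_⟩
    · rw [natDegree_oreMul (X_sub_C_ne_zero _) hN, natDegree_X_sub_C, add_comm]
      refine Nat.succ_le_of_lt (hdeg.trans_lt (Submodule.finrank_lt_finrank_of_lt ?_))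
      -- The order grows only if the span grows: were `eᵢ` in the old span, `N` would already
      -- annihilate it.
      refine lt_of_le_of_ne hle fun heq => h0 ?_
      have h1 : e i ∈ Submodule.span C (e '' s) := by
        rw [heq]
        exact Submodule.subset_span ⟨i, by simp, rfl⟩
      exact (Submodule.span_le (p := solutionSpace N)).2
        (by rintro _ ⟨j, hj, rfl⟩; exact hs j hj) h1
    · rcases Finset.mem_insert.1 hj with rfl | hj
      · rw [mem_solutionSpace, act_oreMul, hρ, act_X_sub_C, deriv_smul, he, smul_smul, smul_smul,
          ← add_smul, ← sub_smul]
        rw [show ρ * u j + Differential.deriv ρ - (u j + Differential.deriv ρ / ρ) * ρ = 0 by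
          field_simp; ring, zero_smul]
      · exact solutionSpace_le_of_oreMul _ _ (hs j hj)

theorem isRightFactor_X_sub_C_of_mem {u : RatFunc C} {e : LaurentSeries C} (hne : e ≠ 0)
    (he : Differential.deriv e = u • e) {N : DiffOp C} (hN : e ∈ solutionSpace N) :
    IsRightFactor (X - Polynomial.C u) N := by
  obtain ⟨A, R, h, hR⟩ := exists_oreMul_add_eq (X_sub_C_ne_zero u) N
  rw [degree_X_sub_C] at hR
  rw [eq_C_of_degree_le_zero (Order.lt_succ_iff.1 (hR.trans_eq (by rfl)))] at h
  have h1 : act N e = 0 := hN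
  rw [h, act_add, act_oreMul, act_X_sub_C, he, sub_self, act_zero_right, zero_add, act_C] at h1
  refine ⟨A, ?_⟩
  rw [h, (smul_eq_zero.1 h1).resolve_right hne, C_0, add_zero]

/-! ### Colon spaces of least common left multiples of first-order operators -/

/-- The first-order operators `D - uᵢ` have `L` as a least common left multiple. -/
def IsExpLCLM {m : ℕ} (u : Fin m → RatFunc C) (L : DiffOp C) : Prop :=
  (∀ i, IsRightFactor (X - Polynomial.C (u i)) L) ∧
    ∀ L' : DiffOp C, L' ≠ 0 → (∀ i, IsRightFactor (X - Polynomial.C (u i)) L') →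
      L.natDegree ≤ L'.natDegree

/-- An operator of order at most the dimension of the span annihilates all `eᵢ`, so it is a common
left multiple of the `D - uᵢ`. Minimality of `L` bounds `dim V(L) = ord L` by that dimension. -/
theorem solutionSpace_le_span_of_isExpLCLM [CharZero C] {m : ℕ} {u : Fin m → RatFunc C}
    {L : DiffOp C} (hL : L ≠ 0) (hLf : Module.finrank C (solutionSpace L) = L.natDegree)
    (hu : IsExpLCLM u L) : ∃ e : Fin m → LaurentSeries C, (∀ i, e i ≠ 0) ∧
      (∀ i, Differential.deriv (e i) = u i • e i) ∧ (∀ i, e i ∈ solutionSpace L) ∧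
      solutionSpace L ≤ Submodule.span C (Set.range e) := by
  choose e hne he hmem using fun i => exists_exponential_mem_solutionSpace hL hLf (hu.1 i)
  refine ⟨e, hne, he, hmem, ?_⟩
  obtain ⟨N, hN, hdeg, hs⟩ := exists_op_of_exponentials he Finset.univ
  rw [Finset.coe_univ, Set.image_univ] at hdeg
  have hle : Submodule.span C (Set.range e) ≤ solutionSpace L :=
    Submodule.span_le.2 (by rintro _ ⟨i, rfl⟩; exact hmem i)
  obtain ⟨_, -⟩ := finite_solutionSpace hL
  refine (Submodule.eq_of_le_of_finrank_le hle ?_).ge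
  rw [hLf]
  exact (hu.2 N hN fun i => isRightFactor_X_sub_C_of_mem (hne i) (he i)
    (hs i (Finset.mem_univ i))).trans hdeg

/-- Multiplication by a Laurent series. -/
def mulLinear (e : LaurentSeries C) : LaurentSeries C →ₗ[C] LaurentSeries C where
  toFun f := f * e
  map_add' f g := add_mul f g e
  map_smul' c f := smul_mul_assoc c f e

theorem mem_colonSpace_iff {m : ℕ} {u : Fin m → RatFunc C} {e : Fin m → LaurentSeries C}
    {L M : DiffOp C} (hne : ∀ i, e i ≠ 0) (he : ∀ i, Differential.deriv (e i) = u i • e i)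
    (hmem : ∀ i, e i ∈ solutionSpace L)
    (hspan : solutionSpace L ≤ Submodule.span C (Set.range e)) (h : LaurentSeries C) :
    h ∈ colonSpace (solutionSpace M) (solutionSpace L : Set (LaurentSeries C)) ↔
      ∀ i, act (expShift (u i) M) h = 0 := by
  constructor
  · intro hh i
    have h1 : act M (h * e i) = 0 := hh _ (hmem i)
    rw [act_expShift (he i)] at h1
    exact (mul_eq_zero.1 h1).resolve_right (hne i)
  · intro hh g hg
    have key : Submodule.span C (Set.range e) ≤ (solutionSpace M).comap (mulLinear h) := by
      refine Submodule.span_le.2 ?_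
      rintro _ ⟨i, rfl⟩
      change act M (e i * h) = 0
      rw [mul_comm, act_expShift (he i), hh, zero_mul]
    rw [mul_comm]
    exact key (hspan hg)

/-- Multiplication by `e⁻¹` embeds `V(M)` in the solution space of the shifted operator, which has
the same order. -/
theorem finrank_solutionSpace_expShift [CharZero C] {u : RatFunc C} {e : LaurentSeries C}
    (hne : e ≠ 0) (he : Differential.deriv e = u • e) {M : DiffOp C} (hM : M ≠ 0)
    (hMf : Module.finrank C (solutionSpace M) = M.natDegree) :
    Module.finrank C (solutionSpace (expShift u M)) = (expShift u M).natDegree := by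
  obtain ⟨_, hle⟩ := finite_solutionSpace (expShift_ne_zero u hM)
  refine hle.antisymm ?_
  have hinj : Function.Injective (mulLinear e⁻¹) := fun f g h =>
    mul_right_cancel₀ (inv_ne_zero hne) h
  rw [natDegree_expShift u hM, ← hMf,
    (Submodule.equivMapOfInjective (mulLinear e⁻¹) hinj (solutionSpace M)).finrank_eq]
  refine Submodule.finrank_mono ?_
  rintro _ ⟨f, hf, rfl⟩
  have h1 := act_expShift he M (f * e⁻¹)
  rw [mul_assoc, inv_mul_cancel₀ hne, mul_one, show act M f = 0 from hf] at h1
  exact (mul_eq_zero.1 h1.symm).resolve_right hne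

/-- The colon space is the solution space of the greatest common right divisor of the operators
`M` with `D` replaced by `D + uᵢ`. -/
theorem solutionSpace_eq_colonSpace [CharZero C] {m : ℕ} {u : Fin m → RatFunc C}
    {L M Q : DiffOp C} (hL : 0 < L.natDegree) (hM : M ≠ 0)
    (hLf : Module.finrank C (solutionSpace L) = L.natDegree)
    (hMf : Module.finrank C (solutionSpace M) = M.natDegree) (hu : IsExpLCLM u L)
    {A B : Fin m → DiffOp C} (hA : Q = ∑ i, oreMul (A i) (expShift (u i) M))
    (hB : ∀ i, expShift (u i) M = oreMul (B i) Q) :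
    solutionSpace Q = colonSpace (solutionSpace M) (solutionSpace L : Set (LaurentSeries C)) ∧
      Module.finrank C (solutionSpace Q) = Q.natDegree := by
  have hL0 := ne_zero_of_natDegree_gt hL
  obtain ⟨e, hne, he, hmem, hspan⟩ := solutionSpace_le_span_of_isExpLCLM hL0 hLf hu
  constructor
  · ext h
    rw [mem_colonSpace_iff hne he hmem hspan, mem_solutionSpace]
    constructor
    · intro hh i
      rw [hB, act_oreMul, hh, act_zero_right]
    · intro hh
      have key (s : Finset (Fin m)) :
          act (∑ i ∈ s, oreMul (A i) (expShift (u i) M)) h = 0 := by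
        induction s using Finset.induction_on with
        | empty => rw [Finset.sum_empty, act_zero]
        | insert a s ha ih =>
          rw [Finset.sum_insert ha, act_add, ih, act_oreMul, hh, act_zero_right, add_zero]
      rw [hA, key]
  -- One index suffices for fullness: `Q` is a right factor of `expShift (u i) M`.
  · obtain ⟨i⟩ : Nonempty (Fin m) := by
      by_contra hempty
      rw [not_nonempty_iff] at hempty
      rw [Set.range_eq_empty, Submodule.span_empty, le_bot_iff] at hspan
      rw [hspan, finrank_bot] at hLf
      omega
    have h0 := expShift_ne_zero (u i) hM
    have hf := finrank_solutionSpace_expShift (hne i) (he i) hM hMf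
    have hB0 : B i ≠ 0 := fun h => h0 (by rw [hB, h, zero_oreMul])
    have hQ0 : Q ≠ 0 := fun h => h0 (by rw [hB, h, oreMul_zero])
    rw [hB i] at hf
    exact finrank_solutionSpace_of_oreMul hB0 hQ0 hf

/-- Bézout's identity for greatest common right divisors. -/
theorem exists_gcrd {m : ℕ} (N : Fin m → DiffOp C) (hN : ∃ i, N i ≠ 0) :
    ∃ Q : DiffOp C, IsPrimitiveOp Q ∧ ∃ A B : Fin m → DiffOp C,
      Q = ∑ i, oreMul (A i) (N i) ∧ ∀ i, N i = oreMul (B i) Q := by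
  classical
  have hmem (i : Fin m) : N i = ∑ j, oreMul ((Pi.single i 1 : Fin m → DiffOp C) j) (N j) := by
    rw [Finset.sum_eq_single i]
    · rw [Pi.single_eq_same, one_oreMul]
    · intro j _ hj
      rw [Pi.single_eq_of_ne hj, zero_oreMul]
    · simp
  have hex : ∃ n : ℕ, ∃ A : Fin m → DiffOp C, ∑ i, oreMul (A i) (N i) ≠ 0 ∧
      (∑ i, oreMul (A i) (N i)).natDegree = n := by
    obtain ⟨i, hi⟩ := hN
    exact ⟨_, Pi.single i 1, by rwa [← hmem], rfl⟩
  obtain ⟨A, h0, hn⟩ := Nat.find_spec hex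
  set P := ∑ i, oreMul (A i) (N i) with hP
  obtain ⟨a, ha, hprim⟩ := exists_isPrimitiveOp_C_mul h0
  have hdvd (i : Fin m) : ∃ B, N i = oreMul B P := by
    obtain ⟨B, R, h, hR⟩ := exists_oreMul_add_eq h0 (N i)
    refine ⟨B, ?_⟩
    suffices hR0 : R = 0 by rw [h, hR0, add_zero]
    by_contra hR0
    -- The remainder lies in the left ideal generated by the `N j`, in which `P` has minimal order.
    have hRsum : R = ∑ j, oreMul ((Pi.single i 1 : Fin m → DiffOp C) j - oreMul B (A j)) (N j) := by
      simp only [sub_oreMul, Finset.sum_sub_distrib, oreMul_assoc]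
      rw [← hmem, ← oreMul_sum, ← hP, h, add_sub_cancel_left]
    have hle := Nat.find_min' hex ⟨_, by rwa [← hRsum], rfl⟩
    rw [← hRsum, ← hn] at hle
    exact absurd (natDegree_lt_natDegree hR0 hR) (not_lt.2 hle)
  choose B hB using hdvd
  refine ⟨Polynomial.C a * P, hprim, fun i => Polynomial.C a * A i,
    fun i => oreMul (B i) (Polynomial.C a⁻¹), ?_, fun i => ?_⟩
  · simp only [C_mul_oreMul, ← Finset.mul_sum]
    rfl
  · rw [oreMul_assoc, C_oreMul, ← mul_assoc, ← C_mul, inv_mul_cancel₀ ha, C_1, one_mul, hB]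

theorem IsExpLCLM.shift {m : ℕ} {u : Fin m → RatFunc C} {L : DiffOp C} (h : IsExpLCLM u L)
    (ξ : C) : IsExpLCLM (fun i => ratShift ξ (u i)) (shift ξ L) := by
  have e (ζ : C) (v : RatFunc C) : SymmetricDivision.shift ζ (X - Polynomial.C v) =
      X - Polynomial.C (ratShift ζ v) := by
    rw [SymmetricDivision.shift, Polynomial.map_sub, map_X, map_C]
  refine ⟨fun i => ?_, fun L' h0 h' => ?_⟩
  · rw [← e]
    exact (h.1 i).shift ξ
  · have := h.2 (SymmetricDivision.shift (-ξ) L') (shift_ne_zero _ h0) fun i => by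
      have := (h' i).shift (-ξ)
      rwa [e, ratShift_neg_ratShift] at this
    rwa [natDegree_shift] at this ⊢

/-- Each first-order operator is `a (D - u)` with `a ≠ 0`, and a unit on the left does not affect
being a right factor. -/
theorem IsLCLM.exists_isExpLCLM {m : ℕ} {Ls : Fin m → DiffOp C} {L : DiffOp C}
    (hLs : ∀ i, (Ls i).natDegree = 1) (h : IsLCLM Ls L) :
    ∃ u : Fin m → RatFunc C, IsExpLCLM u L := by
  have key (i : Fin m) : ∃ a u : RatFunc C, a ≠ 0 ∧
      Ls i = Polynomial.C a * (X - Polynomial.C u) := by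
    have ha : (Ls i).coeff 1 ≠ 0 := by
      rw [← hLs i, coeff_natDegree, Ne, leadingCoeff_eq_zero]
      rintro h0
      simpa [h0] using hLs i
    refine ⟨(Ls i).coeff 1, -((Ls i).coeff 0 / (Ls i).coeff 1), ha, ?_⟩
    conv_lhs => rw [eq_X_add_C_of_natDegree_le_one (hLs i).le]
    rw [mul_sub, ← C_mul, mul_neg, mul_div_cancel₀ _ ha, C_neg, sub_neg_eq_add]
  choose a u ha hu using key
  have hiff (i : Fin m) (N : DiffOp C) :
      IsRightFactor (X - Polynomial.C (u i)) N ↔ IsRightFactor (Ls i) N := by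
    constructor
    · rintro ⟨A, rfl⟩
      refine ⟨oreMul A (Polynomial.C (a i)⁻¹), ?_⟩
      rw [hu, oreMul_assoc, C_oreMul, ← mul_assoc, ← C_mul, inv_mul_cancel₀ (ha i), C_1, one_mul]
    · rintro ⟨A, rfl⟩
      refine ⟨oreMul A (Polynomial.C (a i)), ?_⟩
      rw [hu, oreMul_assoc, C_oreMul]
  refine ⟨u, fun i => (hiff i L).2 (h.2.1 i), fun L' h0 h' => h.2.2 L' h0 fun i => ?_⟩
  exact (hiff i L').1 (h' i)

/-! ### The global operator of the colon spaces -/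

/-- At all common ordinary points of `L` and `M`, the colon space is the full solution space of
the primitive operator `Q`. -/
def IsColonOperator (M L Q : DiffOp C) : Prop :=
  IsPrimitiveOp Q ∧ ∀ ξ : C, IsOrdinaryPoint ξ L → IsOrdinaryPoint ξ M →
    solutionSpaceAt ξ Q = colonSpaceAt ξ M L ∧
      Module.finrank C (solutionSpaceAt ξ Q) = Q.natDegree

theorem IsOrdinaryPoint.finrank_solutionSpaceAt [CharZero C] {ξ : C} {L : DiffOp C}
    (h : IsOrdinaryPoint ξ L) (hL : L ≠ 0) :
    Module.finrank C (solutionSpaceAt ξ L) = L.natDegree := by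
  rw [← natDegree_shift ξ]
  exact finrank_solutionSpace_of_regular (shift_ne_zero ξ hL) h.isRegularAtZero_shift

theorem exists_isColonOperator [CharZero C] {m : ℕ} {u : Fin m → RatFunc C} {L M : DiffOp C}
    (hL : 0 < L.natDegree) (hM : M ≠ 0) (hm : 0 < m) (hu : IsExpLCLM u L) :
    ∃ Q, IsColonOperator M L Q := by
  obtain ⟨Q, hQ, A, B, hA, hB⟩ := exists_gcrd (fun i => expShift (u i) M)
    ⟨⟨0, hm⟩, expShift_ne_zero _ hM⟩
  refine ⟨Q, hQ, fun ξ hξL hξM => ?_⟩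
  have hL0 := ne_zero_of_natDegree_gt hL
  have h := solutionSpace_eq_colonSpace (L := shift ξ L) (M := shift ξ M) (Q := shift ξ Q)
    (A := fun i => shift ξ (A i)) (B := fun i => shift ξ (B i))
    (by rwa [natDegree_shift]) (shift_ne_zero ξ hM)
    (finrank_solutionSpace_of_regular (shift_ne_zero ξ hL0) hξL.isRegularAtZero_shift)
    (finrank_solutionSpace_of_regular (shift_ne_zero ξ hM) hξM.isRegularAtZero_shift)
    (hu.shift ξ) (by
      conv_lhs => rw [hA, shift, Polynomial.map_sum]
      refine Finset.sum_congr rfl fun i _ => ?_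
      rw [← shift_expShift, ← shift_oreMul, shift]) (fun i => by
      rw [← shift_expShift, hB, shift_oreMul])
  rwa [natDegree_shift] at h

/-- Otherwise, cancelling leading terms leaves a nonzero operator of order below `ord P` that
annihilates the space `V(P)` of dimension `ord P`. -/
theorem eq_C_mul_of_solutionSpace_le [CharZero C] {P Q : DiffOp C} (hP : P ≠ 0) (hQ : Q ≠ 0)
    (hdeg : P.natDegree = Q.natDegree)
    (hPf : Module.finrank C (solutionSpace P) = P.natDegree)
    (hle : solutionSpace P ≤ solutionSpace Q) : ∃ a : RatFunc C, a ≠ 0 ∧ P = Polynomial.C a * Q := by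
  have hp := leadingCoeff_ne_zero.2 hP
  have hq := leadingCoeff_ne_zero.2 hQ
  have ha : P.leadingCoeff / Q.leadingCoeff ≠ 0 := div_ne_zero hp hq
  refine ⟨_, ha, ?_⟩
  by_contra hne
  have h0 := sub_ne_zero.2 hne
  have hlt : (P - Polynomial.C (P.leadingCoeff / Q.leadingCoeff) * Q).degree < P.degree := by
    refine degree_sub_lt_left ?_ hP ?_
    · rw [degree_C_mul ha, degree_eq_natDegree hP, degree_eq_natDegree hQ, hdeg]
    · rw [leadingCoeff_mul, leadingCoeff_C, div_mul_cancel₀ _ hq]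
  obtain ⟨_, h1⟩ := finite_solutionSpace h0
  have h2 : Module.finrank C (solutionSpace P) ≤ _ := Submodule.finrank_mono (t := solutionSpace
    (P - Polynomial.C (P.leadingCoeff / Q.leadingCoeff) * Q)) fun f hf => by
      have hf' := hle hf
      rw [mem_solutionSpace] at hf hf' ⊢
      rw [act_sub, act_C_mul, hf, hf', smul_zero, sub_zero]
  have h3 := natDegree_lt_natDegree h0 hlt
  omega

theorem AnnihilatesProducts.solutionSpace_le {L P M : DiffOp C} (h : AnnihilatesProducts L P M) :
    solutionSpace P ≤ colonSpace (solutionSpace M) (solutionSpace L : Set (LaurentSeries C)) := by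
  intro f hf g hg
  rw [mul_comm]
  exact h (LaurentSeries C) g f hg hf

/-! ### Maximality and uniqueness of the colon operator -/

section

variable [CharZero C] {L M Q : DiffOp C}

/-- At a common ordinary point of `L` and `M`, both `L` and `Q` have full solution spaces, and the
colon property says that products of their solutions lie in `V(M)`. -/
theorem IsColonOperator.annihilatesProducts (hQ : IsColonOperator M L Q) (hL : L ≠ 0) :
    AnnihilatesProducts L Q M := by
  obtain ⟨ξ, h1, h2, -⟩ := exists_isOrdinaryPoint L M M
  obtain ⟨h3, h4⟩ := hQ.2 ξ h1 h2
  have h := annihilatesProducts_of_finrank (L := shift ξ L) (Q := shift ξ Q) (M := shift ξ M)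
    (shift_ne_zero ξ hL) (shift_ne_zero ξ hQ.1.ne_zero)
    (by rw [natDegree_shift]; exact h1.finrank_solutionSpaceAt hL)
    (by rw [natDegree_shift]; exact h4) (fun f hf g hg => by
      have hg' : g ∈ colonSpaceAt ξ M L := by
        rw [← h3]
        exact hg
      rw [mul_comm]
      exact hg' f hf)
  simpa only [shift_neg_shift] using h.shift (-ξ)

theorem IsColonOperator.natDegree_le (hQ : IsColonOperator M L Q) {P : DiffOp C}
    (hP : AnnihilatesProducts L P M) : P.natDegree ≤ Q.natDegree := by
  by_cases hP0 : P = 0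
  · rw [hP0, natDegree_zero]
    exact Nat.zero_le _
  -- The point is also ordinary for `P`, so that `ord P` is the dimension of `V(P)`, a subspace of
  -- the colon space.
  obtain ⟨ξ, h1, h2, h5⟩ := exists_isOrdinaryPoint L M P
  obtain ⟨h3, h4⟩ := hQ.2 ξ h1 h2
  have : Module.Finite C (solutionSpaceAt ξ Q) :=
    (finite_solutionSpace (shift_ne_zero ξ hQ.1.ne_zero)).1
  rw [← h4, ← h5.finrank_solutionSpaceAt hP0]
  refine Submodule.finrank_mono ?_
  rw [h3]
  exact (hP.shift ξ).solutionSpace_le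

theorem IsColonOperator.eq_of_natDegree_eq (hQ : IsColonOperator M L Q) {P : DiffOp C}
    (hP : IsPrimitiveOp P) (h : AnnihilatesProducts L P M) (hdeg : P.natDegree = Q.natDegree) :
    P = Q := by
  obtain ⟨ξ, h1, h2, h5⟩ := exists_isOrdinaryPoint L M P
  obtain ⟨a, ha, h6⟩ := eq_C_mul_of_solutionSpace_le (shift_ne_zero ξ hP.ne_zero)
    (shift_ne_zero ξ hQ.1.ne_zero) (by rw [natDegree_shift, natDegree_shift, hdeg])
    (by rw [natDegree_shift]; exact h5.finrank_solutionSpaceAt hP.ne_zero)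
    ((h.shift ξ).solutionSpace_le.trans (hQ.2 ξ h1 h2).1.ge)
  have h7 := congrArg (shift (-ξ)) h6
  rw [shift_C_mul, shift_neg_shift, shift_neg_shift] at h7
  exact hP.eq_of_C_mul hQ.1 ((_root_.map_ne_zero _).2 ha) h7

theorem IsColonOperator.isQuasiSymQuotient_iff (hQ : IsColonOperator M L Q) (hL : L ≠ 0)
    (P : DiffOp C) : IsQuasiSymQuotient M L P ↔ P = Q := by
  have hQs : SymProdIsRightFactor L Q M :=
    (hQ.annihilatesProducts hL).symProdIsRightFactor hL hQ.1.ne_zero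
  constructor
  · rintro ⟨hP, hs, hmax⟩
    exact hQ.eq_of_natDegree_eq hP hs.annihilatesProducts
      ((hQ.natDegree_le hs.annihilatesProducts).antisymm (hmax Q hQs))
  · rintro rfl
    exact ⟨hQ.1, hQs, fun P hP => hQ.natDegree_le hP.annihilatesProducts⟩

theorem IsColonOperator.local_quotients (hQ : IsColonOperator M L Q) (hL : L ≠ 0) {ξ : C}
    (hξL : IsOrdinaryPoint ξ L) (hξM : IsOrdinaryPoint ξ M) :
    (∀ h ∈ colonSpaceAt ξ M L, IsDFiniteAt ξ h) ∧
      (∀ h ∈ colonSpaceAt ξ M L, ∀ Qh : DiffOp C,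
        IsMinimalAnnihilatorAt ξ h Qh →
          solutionSpaceAt ξ Qh ≤ colonSpaceAt ξ M L ∧
          Module.rank C (solutionSpaceAt ξ Qh) = Qh.natDegree) ∧
      ∃ Q, IsLocalQuasiSymQuotient ξ M L Q := by
  obtain ⟨hspace, hfin⟩ := hQ.2 ξ hξL hξM
  rw [← hspace]
  refine ⟨fun h hh => ⟨Q, hQ.1.ne_zero, hh⟩, fun h hh Qh hmin => ?_, Q, hQ.1, hspace,
    (hQ.annihilatesProducts hL).symProdIsRightFactor hL hQ.1.ne_zero⟩
  obtain ⟨h0, hQh, hmin⟩ := hmin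
  obtain ⟨A, R, hAR, hR⟩ := exists_oreMul_add_eq h0 Q
  -- The remainder of `Q` modulo `Qh` annihilates `h` and has order below `ord Qh`. So `Qh` is a
  -- right factor of `Q` and inherits a full solution space.
  have hR0 : R = 0 := by
    by_contra hR0
    refine absurd (natDegree_lt_natDegree hR0 hR) (not_lt.2 (hmin R hR0 ?_))
    have h1 : act (shift ξ Q) h = 0 := hh
    have h2 : act (shift ξ Qh) h = 0 := hQh
    rwa [hAR, shift_add, shift_oreMul, act_add, act_oreMul, h2, act_zero_right, zero_add] at h1
  rw [hR0, add_zero] at hAR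
  have hA0 : A ≠ 0 := fun h => hQ.1.ne_zero (by rw [hAR, h, zero_oreMul])
  have hshift : shift ξ Q = oreMul (shift ξ A) (shift ξ Qh) := by rw [hAR, shift_oreMul]
  obtain ⟨_, -⟩ := finite_solutionSpace (shift_ne_zero ξ h0)
  constructor
  · rw [solutionSpaceAt, solutionSpaceAt, hshift]
    exact solutionSpace_le_of_oreMul _ _
  · have hf := finrank_solutionSpace_of_oreMul (shift_ne_zero ξ hA0) (shift_ne_zero ξ h0) (by
      rw [← hshift, natDegree_shift]
      exact hfin)
    rw [natDegree_shift] at hf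
    rw [solutionSpaceAt, ← hf]
    exact (Module.finrank_eq_rank C _).symm

end

/-! ### Truncations and approximants -/

theorem act_map_eq_sum {δ : ℕ} {q : C[X][X]} (hq : q.natDegree ≤ δ) (f : LaurentSeries C) :
    act (q.map (algebraMap C[X] (RatFunc C))) f = ∑ i : Fin (δ + 1),
      algebraMap C[X] (LaurentSeries C) (q.coeff i) *
        (Differential.deriv (R := LaurentSeries C))^[i] f := by
  rw [act_eq_sum_fin (r := δ + 1)]
  · refine Finset.sum_congr rfl fun i _ => ?_
    rw [coeff_map, Algebra.smul_def, ← div_one (algebraMap C[X] (RatFunc C) _),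
      ← map_one (algebraMap C[X] (RatFunc C))]
    congr 1
    refine (RatFunc.algebraMap_apply_div _ _).trans ?_
    rw [map_one, div_one]
  · refine degree_lt_iff_coeff_zero _ _ |>.2 fun n hn => ?_
    rw [coeff_map, coeff_eq_zero_of_natDegree_lt (by omega), map_zero]

theorem coeff_algebraMap_of_neg (p : C[X]) {n : ℤ} (hn : n < 0) :
    (algebraMap C[X] (LaurentSeries C) p).coeff n = 0 := by
  rw [Polynomial.algebraMap_hahnSeries_apply, PowerSeries.coeff_coe, if_pos hn]

/-- Polynomial coefficients do not lower exponents, and at most `δ` derivatives lower them by at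
most `δ`. This is why truncation at `k` preserves the result below `k - δ`. -/
theorem coeff_act_map_eq_zero {δ : ℕ} {q : C[X][X]} (hq : q.natDegree ≤ δ) {k : ℤ}
    {f : LaurentSeries C} (hf : ∀ n < k + 1, f.coeff n = 0) {n : ℤ} (hn : n < k - δ) :
    (act (q.map (algebraMap C[X] (RatFunc C))) f).coeff n = 0 := by
  rw [act_map_eq_sum hq, HahnSeries.coeff_sum]
  refine Finset.sum_eq_zero fun i _ => ?_
  refine coeff_mul_eq_zero_of_lt (s := 0) (t := k + 1 - i)
    (fun n hn => coeff_algebraMap_of_neg _ hn)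
    (fun n hn => coeff_iterate_deriv_eq_zero hf i hn) ?_
  have := i.2
  omega

theorem act_sub_right (L : DiffOp C) (f g : LaurentSeries C) : act L (f - g) = act L f - act L g :=
  map_sub (actLinear L) f g

theorem coeff_act_map_truncate {δ : ℕ} {q : C[X][X]} (hq : q.natDegree ≤ δ) (k : ℤ)
    (f : LaurentSeries C) {n : ℤ} (hn : n < k - δ) :
    (act (q.map (algebraMap C[X] (RatFunc C))) (truncate k f)).coeff n =
      (act (q.map (algebraMap C[X] (RatFunc C))) f).coeff n := by
  have h := coeff_act_map_eq_zero hq (k := k) (f := f - truncate k f) (fun m hm => by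
    rw [HahnSeries.coeff_sub, truncate, HahnSeries.coeff_truncLT_of_lt hm, sub_self]) hn
  rw [act_sub_right, HahnSeries.coeff_sub, sub_eq_zero] at h
  exact h.symm

/-- A finite-dimensional family of Laurent series has elements that are determined by finitely many
terms. -/
theorem exists_bound_of_finiteDimensional {E ι : Type*} [AddCommGroup E] [Module C E]
    [Module.Finite C E] (Φ : E →ₗ[C] (ι → LaurentSeries C)) :
    ∃ K : ℕ, ∀ a, (∀ b, ∀ n : ℤ, n < K → (Φ a b).coeff n = 0) → Φ a = 0 := by
  -- Vanishing below exponent `k` defines a descending chain of subspaces of a finite-dimensional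
  -- space. Once the chain is constant, vanishing up to `K` means vanishing everywhere.
  let W : ℕ →o (Submodule C E)ᵒᵈ :=
    { toFun := fun k => OrderDual.toDual
        { carrier := {a | ∀ b, ∀ n : ℤ, n < k → (Φ a b).coeff n = 0}
          zero_mem' := by simp
          add_mem' := fun {x y} hx hy b n hn => by
            simp [hx b n hn, hy b n hn]
          smul_mem' := fun c x hx b n hn => by simp [hx b n hn] }
      monotone' := fun k l hkl a ha b n hn => ha b n (by omega) }
  obtain ⟨K, hK⟩ := IsArtinian.monotone_stabilizes W
  refine ⟨K, fun a ha => ?_⟩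
  funext b
  ext n
  have h1 : a ∈ OrderDual.ofDual (W K) := ha
  rw [hK (max K (n + 1).toNat) (le_max_left _ _)] at h1
  exact h1 b n (by
    have : (n + 1).toNat ≤ max K (n + 1).toNat := le_max_right _ _
    omega)

theorem algebraMap_C_mul_laurentSeries (c : C) (f : LaurentSeries C) :
    algebraMap C[X] (LaurentSeries C) (Polynomial.C c) * f = c • f := by
  rw [Polynomial.algebraMap_hahnSeries_apply, Polynomial.coe_C, HahnSeries.ofPowerSeries_C,
    HahnSeries.C_mul_eq_smul]

theorem exists_bound_act_map (U : Submodule C (LaurentSeries C)) (δ d : ℕ) :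
    ∃ K : ℕ, ∀ q : C[X][X], q.natDegree ≤ δ → (∀ i, (q.coeff i).natDegree ≤ d) →
      (∀ f ∈ U, ∀ n : ℤ, n < K → (act (q.map (algebraMap C[X] (RatFunc C))) f).coeff n = 0) →
      ∀ f ∈ U, act (q.map (algebraMap C[X] (RatFunc C))) f = 0 := by
  -- The finite-dimensional family consists of all operators of order at most `δ` and degree at most
  -- `d`, given by their coefficient tables.
  let Φ : (Fin (δ + 1) → Fin (d + 1) → C) →ₗ[C] (U → LaurentSeries C) :=
    { toFun := fun a f => ∑ i, ∑ j, a i j • (algebraMap C[X] (LaurentSeries C) (X ^ (j : ℕ)) *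
        (Differential.deriv (R := LaurentSeries C))^[i] (f : LaurentSeries C))
      map_add' := fun a b => by
        funext f
        simp only [Pi.add_apply, add_smul, Finset.sum_add_distrib]
      map_smul' := fun c a => by
        funext f
        simp only [Pi.smul_apply, smul_eq_mul, mul_smul, Finset.smul_sum, RingHom.id_apply] }
  obtain ⟨K, hK⟩ := exists_bound_of_finiteDimensional Φ
  refine ⟨K, fun q hq hd h => ?_⟩
  have key (f : U) : Φ (fun i j => (q.coeff i).coeff j) f =
      act (q.map (algebraMap C[X] (RatFunc C))) (f : LaurentSeries C) := by
    rw [act_map_eq_sum hq]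
    change ∑ i : Fin (δ + 1), ∑ j : Fin (d + 1), (q.coeff i).coeff j •
      (algebraMap C[X] (LaurentSeries C) (X ^ (j : ℕ)) *
        (Differential.deriv (R := LaurentSeries C))^[i] (f : LaurentSeries C)) = _
    refine Finset.sum_congr rfl fun i _ => ?_
    conv_rhs => rw [as_sum_range_C_mul_X_pow' (q.coeff i) (Nat.lt_succ_of_le (hd i)),
      map_sum, Finset.sum_mul, ← Fin.sum_univ_eq_sum_range
      (fun j => algebraMap C[X] (LaurentSeries C) (Polynomial.C ((q.coeff i).coeff j) * X ^ j) *
        (Differential.deriv (R := LaurentSeries C))^[i] (f : LaurentSeries C))]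
    refine Finset.sum_congr rfl fun j _ => ?_
    rw [map_mul, mul_assoc, algebraMap_C_mul_laurentSeries]
  have h0 := hK (fun i j => (q.coeff i).coeff j) fun f n hn => by
    rw [key]
    exact h f f.2 n hn
  intro f hf
  rw [← key ⟨f, hf⟩, h0]
  rfl

theorem coeff_act_eq_zero_of_basis {ι : Type*} [Fintype ι] {U : Submodule C (LaurentSeries C)}
    (b : Module.Basis ι C U) (Q : DiffOp C) (N : ℤ)
    (h : ∀ j, ∀ n < N, (act Q (b j : LaurentSeries C)).coeff n = 0) :
    ∀ f ∈ U, ∀ n < N, (act Q f).coeff n = 0 := by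
  intro f hf n hn
  have h1 := congrArg (fun g : U => (actLinear Q (g : LaurentSeries C)).coeff n)
    (b.sum_repr ⟨f, hf⟩)
  have h2 : (act Q f).coeff n = _ := h1.symm
  rw [h2]
  simp only [Submodule.coe_sum, Submodule.coe_smul, map_sum, map_smul, HahnSeries.coeff_sum,
    HahnSeries.coeff_smul]
  exact Finset.sum_eq_zero fun j _ => by
    rw [show (actLinear Q (b j : LaurentSeries C)).coeff n = 0 from h j n hn, smul_zero]

/-! ### The initial precision -/

theorem exists_isIndicialPoly [CharZero C] {N : DiffOp C} (hN : N ≠ 0) :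
    ∃ p, IsIndicialPoly N p := by
  obtain ⟨σ, h1, h2⟩ := exists_laurentIndicial_ne_zero
    ((Polynomial.map_ne_zero_iff (algebraMap (RatFunc C) (LaurentSeries C)).injective).2 hN)
  exact ⟨indicialCoeff N σ, by rwa [indicialCoeff_eq_laurentIndicial], σ, rfl, fun e he => by
    rw [indicialCoeff_eq_laurentIndicial, h2 e he]⟩

theorem IsIndicialPoly.exists_root_ge [CharZero C] {N : DiffOp C} {p : C[X]}
    (hp : IsIndicialPoly N p) {f : PowerSeries C} (hf : f ≠ 0)
    (hfN : (f : LaurentSeries C) ∈ solutionSpace N) {k : ℕ} (hk : (PowerSeries.X : PowerSeries C) ^ k ∣ f) :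
    ∃ z : ℕ, k ≤ z ∧ p.eval (z : C) = 0 := by
  classical
  obtain ⟨-, σ, rfl, hlow⟩ := hp
  have hex : ∃ n, PowerSeries.coeff n f ≠ 0 := by
    by_contra! h
    exact hf (PowerSeries.ext h)
  refine ⟨Nat.find hex, ?_, ?_⟩
  · by_contra hlt
    exact Nat.find_spec hex (PowerSeries.X_pow_dvd_iff.1 hk _ (not_le.1 hlt))
  · have h := eval_laurentIndicial_eq_zero
      (A := N.map (algebraMap (RatFunc C) (LaurentSeries C))) (σ := σ)
      (fun e he => by rw [← indicialCoeff_eq_laurentIndicial, hlow e he])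
      (f := (f : LaurentSeries C)) (by rw [← act_eq_laurentAct]; exact hfN)
      (ν := (Nat.find hex : ℤ)) (fun n hn => by
        rw [PowerSeries.coeff_coe]
        split_ifs with h0
        · rfl
        · exact not_not.1 (Nat.find_min hex (by omega)))
      (by rw [LaurentSeries.coeff_coe_powerSeries]; exact Nat.find_spec hex)
    rwa [indicialCoeff_eq_laurentIndicial, ← Int.cast_natCast]

/-- With `r = ord L`, the witness is the order of `f g^(r-1)`, a solution of `N`, for suitable
solutions `f` of `M` and `g = x^(r-1) + ⋯` of `L`. It is at least `(r-1)²`. -/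
theorem IsIndicialPoly.exists_root_of_isSymPow [CharZero C] {L M P N : DiffOp C} {p : C[X]}
    (hL : 0 < L.natDegree) (hM : 0 < M.natDegree) (hLreg : IsRegularAtZero L)
    (hMreg : IsRegularAtZero M) (hP : IsSymPow L (L.natDegree - 1) P) (hN : IsSymProd M P N)
    (hp : IsIndicialPoly N p) :
    ∃ z : ℕ, (L.natDegree - 1) * (L.natDegree - 1) ≤ z ∧ p.eval (z : C) = 0 := by
  obtain ⟨f, hf, hf1⟩ := exists_powerSeries_solution (ne_zero_of_natDegree_gt hM) hMreg fun _ => 1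
  obtain ⟨g, hg, hg1⟩ := exists_powerSeries_solution (ne_zero_of_natDegree_gt hL) hLreg
    fun i => if i = L.natDegree - 1 then 1 else 0
  have hf0 : f ≠ 0 := by
    rintro rfl
    simpa using hf1 0 hM
  have hg0 : g ≠ 0 := by
    rintro rfl
    simpa using hg1 (L.natDegree - 1) (by omega)
  have hdvd : (PowerSeries.X : PowerSeries C) ^ (L.natDegree - 1) ∣ g := by
    refine PowerSeries.X_pow_dvd_iff.2 fun i hi => ?_
    rw [hg1 i (by omega), if_neg hi.ne]
  refine hp.exists_root_ge (f := f * g ^ (L.natDegree - 1)) (mul_ne_zero hf0 (pow_ne_zero _ hg0)) ?_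
    (Dvd.dvd.mul_left (by rw [pow_mul]; exact pow_dvd_pow_of_dvd hdvd _) _)
  rw [map_mul, map_pow]
  exact hN.2.1 (LaurentSeries C) _ _ hf (hP.pow_mem_solutionSpace hg)

theorem exists_isInitialPrecision [CharZero C] {L M : DiffOp C}
    (hL : 0 < L.natDegree) (hM : 0 < M.natDegree) (hLreg : IsRegularAtZero L)
    (hMreg : IsRegularAtZero M) : ∃ k₀, IsInitialPrecision M L k₀ := by
  obtain ⟨P, hP, hP0⟩ := exists_isSymPow (ne_zero_of_natDegree_gt hL) (L.natDegree - 1)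
  obtain ⟨N, hN⟩ := exists_isSymProd (ne_zero_of_natDegree_gt hM) hP0
  obtain ⟨p, hp⟩ := exists_isIndicialPoly hN.1.ne_zero
  obtain ⟨z, -, hz⟩ := hp.exists_root_of_isSymPow hL hM hLreg hMreg hP hN
  have hfin : {k : ℕ | p.eval (k : C) = 0}.Finite :=
    ((p.rootSet_finite C).preimage Nat.cast_injective.injOn).subset fun k hk => by
      simpa [mem_rootSet, hp.1] using hk
  obtain ⟨y, hy, hmax⟩ := Set.exists_max_image _ id hfin ⟨z, hz⟩
  exact ⟨_, P, N, p, y, hP, hN, hp, ⟨hy, hmax⟩, rfl⟩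

theorem IsInitialPrecision.nonneg [CharZero C] {L M : DiffOp C} {k₀ : ℤ}
    (hL : 0 < L.natDegree) (hM : 0 < M.natDegree) (hLreg : IsRegularAtZero L)
    (hMreg : IsRegularAtZero M) (h : IsInitialPrecision M L k₀) : 0 ≤ k₀ := by
  obtain ⟨P, N, p, z, hP, hN, hp, hz, rfl⟩ := h
  obtain ⟨y, hy, hy0⟩ := hp.exists_root_of_isSymPow hL hM hLreg hMreg hP hN
  have h1 : y ≤ z := hz.2 hy0
  obtain ⟨s, hs⟩ : ∃ s, L.natDegree = s + 1 := ⟨L.natDegree - 1, by omega⟩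
  rw [hs, Nat.add_sub_cancel] at hy
  rw [hs, Nat.add_sub_cancel]
  -- With `s = r - 1`: the root `(r-1)²` or larger outweighs the subtracted `r(r-1)/2`. Hence the
  -- first precision `k₀ + 1` is positive and doubling increases it.
  have h2 : (s + 1) * s / 2 ≤ s * s := Nat.div_le_of_le_mul (by nlinarith [Nat.le_mul_self s])
  omega

/-! ### The algorithm at the point `0` -/

theorem isPrimitiveOp_one : IsPrimitiveOp (1 : DiffOp C) :=
  ⟨1, by simp, isPrimitive_one, by simp⟩

theorem IsPrimitiveOp.eq_one {Q : DiffOp C} (hQ : IsPrimitiveOp Q) (h : Q.natDegree = 0) :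
    Q = 1 := by
  have h1 := eq_C_of_natDegree_eq_zero h
  refine hQ.eq_of_C_mul isPrimitiveOp_one (a := Q.coeff 0) (fun h0 => hQ.ne_zero ?_) ?_
  · rw [h1, h0, C_0]
  · rw [mul_one]
    exact h1

theorem loopDegree_le (δ d₀ : ℕ) (k : ℤ) : loopDegree δ d₀ k ≤ d₀ := min_le_left _ _

theorem loopDegree_eq {δ d₀ : ℕ} {k : ℤ} (h : ((δ : ℤ) + 1) * (d₀ + 1) + δ ≤ k) :
    loopDegree δ d₀ k = d₀ := by
  refine min_eq_left ?_
  rw [Int.le_ediv_iff_mul_le (by omega)]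
  nlinarith

/-- `Q` is the quasi-symmetric quotient of `M` by `L`, and its solution space at `0` is full and
equal to the colon space. -/
structure IsQuotientAtZero (M L Q : DiffOp C) : Prop where
  solutionSpace_eq : solutionSpace Q =
    colonSpace (solutionSpace M) (solutionSpace L : Set (LaurentSeries C))
  finrank_eq : Module.finrank C (solutionSpace Q) = Q.natDegree
  isQuasiSymQuotient_iff : ∀ P, IsQuasiSymQuotient M L P ↔ P = Q

section

variable {L M Q : DiffOp C}

theorem IsQuotientAtZero.isQuasiSymQuotient (hQ : IsQuotientAtZero M L Q) :
    IsQuasiSymQuotient M L Q := (hQ.isQuasiSymQuotient_iff Q).2 rfl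

theorem IsQuotientAtZero.finite [CharZero C] (hQ : IsQuotientAtZero M L Q) : Module.Finite C
    (colonSpace (solutionSpace M) (solutionSpace L : Set (LaurentSeries C))) := by
  rw [← hQ.solutionSpace_eq]
  exact (finite_solutionSpace hQ.isQuasiSymQuotient.1.ne_zero).1

theorem IsQuotientAtZero.isColonSpaceDimension_iff [CharZero C] (hQ : IsQuotientAtZero M L Q) (δ : ℕ) :
    IsColonSpaceDimension M L δ ↔ δ = Q.natDegree := by
  have := hQ.finite
  rw [IsColonSpaceDimension, ← hQ.finrank_eq, hQ.solutionSpace_eq, ← Module.finrank_eq_rank,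
    Nat.cast_inj, eq_comm]

theorem IsQuotientAtZero.eq_of_isColonSpaceBasis (hQ : IsQuotientAtZero M L Q) {δ : ℕ} {k : ℤ}
    {h : Fin δ → LaurentSeries C} (hb : IsColonSpaceBasis M L k h) : δ = Q.natDegree := by
  obtain ⟨b, -⟩ := hb
  rw [← hQ.finrank_eq, hQ.solutionSpace_eq, Module.finrank_eq_card_basis b, Fintype.card_fin]

theorem IsQuotientAtZero.exists_isColonSpaceBasis [CharZero C] (hQ : IsQuotientAtZero M L Q) {δ : ℕ}
    (hδ : δ = Q.natDegree) (k : ℤ) :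
    ∃ h : Fin δ → LaurentSeries C, IsColonSpaceBasis M L k h := by
  have := hQ.finite
  have hf : Module.finrank C (colonSpace (solutionSpace M)
      (solutionSpace L : Set (LaurentSeries C))) = δ := by
    rw [← hQ.solutionSpace_eq, hQ.finrank_eq, hδ]
  exact ⟨_, Module.finBasisOfFinrankEq C _ hf, fun _ => rfl⟩

/-- Past the threshold the loop allows degree `d₀`, so `Q` is admissible, and it annihilates the
basis exactly. This excludes `None`. -/
theorem IsQuotientAtZero.isApproximantAnnihilator [CharZero C] (hQ : IsQuotientAtZero M L Q) {δ d₀ : ℕ} {k : ℤ}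
    {h : Fin δ → LaurentSeries C} (hb : IsColonSpaceBasis M L k h)
    (hd : IsCoeffDegreeBound M L δ d₀) (hk : ((δ : ℤ) + 1) * (d₀ + 1) + δ ≤ k) :
    IsApproximantAnnihilator h (loopDegree δ d₀ k) k Q := by
  have hδ := hQ.eq_of_isColonSpaceBasis hb
  obtain ⟨b, hb⟩ := hb
  obtain ⟨q, hq, hprim, hmonic⟩ := hQ.isQuasiSymQuotient.1
  have hdeg : q.natDegree = δ := by
    rw [hδ, ← hq, natDegree_map_eq_of_injective (RatFunc.algebraMap_injective C)]
  have hdb := hd q (by rw [hq]; exact hQ.isQuasiSymQuotient) hdeg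
  refine ⟨q, hq, hprim, hmonic, hdeg.le, fun i n hn => ?_, fun j n hn => ?_⟩
  · rw [loopDegree_eq hk] at hn
    exact coeff_eq_zero_of_natDegree_lt ((hdb i).trans_lt (by exact_mod_cast hn))
  · rw [hb, ← hq, coeff_act_map_truncate hdeg.le k _ hn, hq]
    have h1 : (b j : LaurentSeries C) ∈ solutionSpace Q := by
      rw [hQ.solutionSpace_eq]
      exact (b j).2
    rw [show act Q (b j : LaurentSeries C) = 0 from h1, HahnSeries.coeff_zero]

/-- For large precision, every approximant annihilator is the quasi-symmetric quotient. -/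
theorem IsQuotientAtZero.exists_precision [CharZero C] (hQ : IsQuotientAtZero M L Q) (δ d₀ : ℕ) :
    ∃ K : ℤ, ∀ k ≥ K, ∀ h : Fin δ → LaurentSeries C, IsColonSpaceBasis M L k h →
      ∀ P, IsApproximantAnnihilator h (loopDegree δ d₀ k) k P → P = Q := by
  obtain ⟨K, hK⟩ := exists_bound_act_map (colonSpace (solutionSpace M)
    (solutionSpace L : Set (LaurentSeries C))) δ d₀
  refine ⟨K + δ, fun k hk h hb P hP => ?_⟩
  have hδ := hQ.eq_of_isColonSpaceBasis hb
  obtain ⟨b, hb⟩ := hb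
  obtain ⟨p, rfl, hprim, hmonic, hdeg, hcoeff, happ⟩ := hP
  have hPprim : IsPrimitiveOp (p.map (algebraMap C[X] (RatFunc C))) := ⟨p, rfl, hprim, hmonic⟩
  have hzero := hK p hdeg (fun i => natDegree_le_iff_coeff_eq_zero.2 fun n hn =>
      hcoeff i n ((loopDegree_le δ d₀ k).trans_lt (by exact_mod_cast hn)))
    (fun f hf n hn => coeff_act_eq_zero_of_basis b _ (k - δ) (fun j n hn => by
      rw [← coeff_act_map_truncate hdeg k _ hn, ← hb]
      exact happ j n hn) f hf n (by omega))
  have hle : solutionSpace Q ≤ solutionSpace (p.map (algebraMap C[X] (RatFunc C))) :=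
    fun f hf => hzero f (by rwa [← hQ.solutionSpace_eq])
  obtain ⟨_, hfin⟩ := finite_solutionSpace hPprim.ne_zero
  -- Now `δ = dim V(Q) ≤ ord P ≤ δ` for the approximant `P`, so the orders agree and primitivity
  -- gives equality.
  have h1 := Submodule.finrank_mono hle
  have h2 : (p.map (algebraMap C[X] (RatFunc C))).natDegree ≤ p.natDegree := natDegree_map_le
  rw [hQ.finrank_eq] at h1
  obtain ⟨a, ha, hPa⟩ := eq_C_mul_of_solutionSpace_le hQ.isQuasiSymQuotient.1.ne_zero
    hPprim.ne_zero (by omega) hQ.finrank_eq hle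
  exact (hQ.isQuasiSymQuotient.1.eq_of_C_mul hPprim ha hPa).symm

/-! ### Termination at the point `0` -/

theorem acc_done (r : Option (DiffOp C)) :
    Acc (fun t s => LocalStep M L s t) (LocalState.done r) :=
  Acc.intro _ fun t ht => by cases ht

/-- Beyond `B` neither continuing step is possible: an empty answer leads to `None`, and a found
operator equals `Q` and passes the test. Validity of `d₀` plays no role here. -/
theorem IsQuotientAtZero.acc_loop [CharZero C] (hQ : IsQuotientAtZero M L Q) (δ d₀ : ℕ) {k : ℤ} (hk : 0 < k) :
    Acc (fun t s => LocalStep M L s t) (LocalState.loop δ d₀ k) := by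
  obtain ⟨K, hK⟩ := hQ.exists_precision δ d₀
  set B : ℤ := max K (((δ : ℤ) + 1) * (d₀ + 1) + δ) with hB
  have hBK : K ≤ B := le_max_left _ _
  have hBd : ((δ : ℤ) + 1) * (d₀ + 1) + δ ≤ B := le_max_right _ _
  obtain ⟨n, hn⟩ : ∃ n : ℕ, B - k < n := ⟨(B - k).toNat + 1, by omega⟩
  induction n generalizing k with
  | zero =>
    refine Acc.intro _ fun t ht => ?_
    cases ht with
    | return_none => exact acc_done _
    | return_some => exact acc_done _
    | continue_none _ _ _ _ _ _ hlt => omega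
    | continue_some _ _ _ h P hb hout hnot =>
      obtain rfl := hK k (by omega) h hb P hout
      exact absurd ⟨(hQ.eq_of_isColonSpaceBasis hb).symm, hQ.isQuasiSymQuotient.2.1⟩ hnot
  | succ n ih =>
    refine Acc.intro _ fun t ht => ?_
    cases ht with
    | return_none => exact acc_done _
    | return_some => exact acc_done _
    -- Since `k ≥ 1`, doubling `k` lowers `B - k` by at least one.
    | continue_none => exact ih (by omega) (by push_cast at hn; omega)
    | continue_some => exact ih (by omega) (by push_cast at hn; omega)

theorem IsQuotientAtZero.acc_entry [CharZero C] (hQ : IsQuotientAtZero M L Q) (hL : 0 < L.natDegree)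
    (hM : 0 < M.natDegree) (hLreg : IsRegularAtZero L) (hMreg : IsRegularAtZero M) :
    Acc (fun t s => LocalStep M L s t) LocalState.entry := by
  refine Acc.intro _ fun t ht => ?_
  cases ht with
  | dim_zero => exact acc_done _
  | enter_loop δ d₀ k₀ _ _ hk _ =>
    exact hQ.acc_loop δ d₀ (by have := hk.nonneg hL hM hLreg hMreg; omega)

/-! ### Correctness and progress at the point `0` -/

/-- The invariant of the algorithm at `0`. -/
def LocalInvariant (M L Q : DiffOp C) : LocalState C → Prop
  | .entry => True
  | .loop δ d₀ _ => δ = Q.natDegree ∧ IsCoeffDegreeBound M L δ d₀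
  | .done r => r = some Q

theorem IsQuotientAtZero.localInvariant_step [CharZero C] (hQ : IsQuotientAtZero M L Q) {s t : LocalState C}
    (hs : LocalInvariant M L Q s) (hst : LocalStep M L s t) : LocalInvariant M L Q t := by
  cases hst with
  | dim_zero h0 =>
    have h := (hQ.isColonSpaceDimension_iff 0).1 h0
    exact congrArg some (hQ.isQuasiSymQuotient.1.eq_one h.symm).symm
  | enter_loop δ d₀ k₀ hδ _ _ hd => exact ⟨(hQ.isColonSpaceDimension_iff δ).1 hδ, hd⟩
  | return_none δ d₀ k h hb hout hk =>
    exact absurd (hQ.isApproximantAnnihilator hb hs.2 hk) (hout Q)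
  | continue_none => exact hs
  | return_some δ d₀ k h P hb hout hP =>
    obtain ⟨p, hp, hprim, hmonic, -⟩ := hout
    refine congrArg some ((hQ.isQuasiSymQuotient_iff P).1
      ⟨⟨p, hp, hprim, hmonic⟩, hP.2, fun R hR => ?_⟩)
    rw [hP.1, hs.1]
    exact hQ.isQuasiSymQuotient.2.2 R hR
  | continue_some => exact hs

/-- Every subroutine specification has an admissible output and the branches cover all cases, so a
run can stop only in the final state. -/
theorem IsQuotientAtZero.exists_localStep [CharZero C] (hQ : IsQuotientAtZero M L Q) (hL : 0 < L.natDegree)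
    (hM : 0 < M.natDegree) (hLreg : IsRegularAtZero L) (hMreg : IsRegularAtZero M)
    {s : LocalState C} (hs : LocalInvariant M L Q s) :
    (∃ t, LocalStep M L s t) ∨ s = .done (some Q) := by
  cases s with
  | entry =>
    left
    rcases Nat.eq_zero_or_pos Q.natDegree with h0 | h0
    · exact ⟨_, .dim_zero ((hQ.isColonSpaceDimension_iff 0).2 h0.symm)⟩
    · obtain ⟨k₀, hk⟩ := exists_isInitialPrecision hL hM hLreg hMreg
      obtain ⟨q, hq, -⟩ := hQ.isQuasiSymQuotient.1
      -- The sum of the coefficient degrees of `Q` is a valid bound, because `Q` is the only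
      -- quotient.
      refine ⟨_, .enter_loop Q.natDegree (∑ i ∈ Finset.range (q.natDegree + 1),
        (q.coeff i).natDegree) k₀ ((hQ.isColonSpaceDimension_iff _).2 rfl) h0 hk ?_⟩
      intro p hp _ i
      have hpq : p = q := Polynomial.map_injective _ (RatFunc.algebraMap_injective C)
        (((hQ.isQuasiSymQuotient_iff _).1 hp).trans hq.symm)
      rw [hpq]
      by_cases hi : i ≤ q.natDegree
      · exact Finset.single_le_sum (f := fun i => (q.coeff i).natDegree)
          (fun _ _ => Nat.zero_le _) (Finset.mem_range.2 (Nat.lt_succ_of_le hi))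
      · rw [coeff_eq_zero_of_natDegree_lt (not_le.1 hi), natDegree_zero]
        exact Nat.zero_le _
  | loop δ d₀ k =>
    left
    obtain ⟨h, hb⟩ := hQ.exists_isColonSpaceBasis hs.1 k
    by_cases hout : ApproximantAnnihilatorOutput h (loopDegree δ d₀ k) k none
    · rcases le_or_gt (((δ : ℤ) + 1) * (d₀ + 1) + δ) k with hk | hk
      exacts [⟨_, .return_none δ d₀ k h hb hout hk⟩, ⟨_, .continue_none δ d₀ k h hb hout hk⟩]
    · obtain ⟨P, hP⟩ := not_forall_not.1 hout
      by_cases hc : P.natDegree = δ ∧ SymProdIsRightFactor L P M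
      exacts [⟨_, .return_some δ d₀ k h P hb hP hc⟩, ⟨_, .continue_some δ d₀ k h P hb hP hc⟩]
  | done r => exact Or.inr (congrArg _ hs)

end

/-! ### The global algorithm -/

section

variable {L M Q : DiffOp C}

/-- A competitor for the shifted pair is shifted back by `-ξ`, where maximality and uniqueness of
`Q` apply; shifting preserves order and primitivity. -/
theorem IsColonOperator.isQuotientAtZero [CharZero C] (hQ : IsColonOperator M L Q) (hL : L ≠ 0) {ξ : C}
    (hξL : IsOrdinaryPoint ξ L) (hξM : IsOrdinaryPoint ξ M) :
    IsQuotientAtZero (shift ξ M) (shift ξ L) (shift ξ Q) := by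
  obtain ⟨h1, h2⟩ := hQ.2 ξ hξL hξM
  have hback {P : DiffOp C} (hP : SymProdIsRightFactor (shift ξ L) P (shift ξ M)) :
      AnnihilatesProducts L (shift (-ξ) P) M := by
    simpa only [shift_neg_shift] using hP.annihilatesProducts.shift (-ξ)
  have hs : SymProdIsRightFactor (shift ξ L) (shift ξ Q) (shift ξ M) :=
    ((hQ.annihilatesProducts hL).shift ξ).symProdIsRightFactor (shift_ne_zero ξ hL)
      (shift_ne_zero ξ hQ.1.ne_zero)
  refine ⟨h1, by rw [natDegree_shift]; exact h2, fun P => ⟨fun ⟨hP, hPs, hmax⟩ => ?_, ?_⟩⟩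
  · have h3 := hQ.natDegree_le (hback hPs)
    have h4 := hmax _ hs
    rw [natDegree_shift] at h3 h4
    rw [← hQ.eq_of_natDegree_eq (hP.shift (-ξ)) (hback hPs)
      (by rw [natDegree_shift]; exact h3.antisymm h4), shift_shift_neg]
  · rintro rfl
    refine ⟨hQ.1.shift ξ, hs, fun P hP => ?_⟩
    have h3 := hQ.natDegree_le (hback hP)
    rwa [natDegree_shift] at h3 ⊢

theorem acc_returned (r : Option (DiffOp C)) :
    Acc (fun t s => GlobalStep M L s t) (GlobalState.returned r) :=
  Acc.intro _ fun t ht => by cases ht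

theorem acc_running {ξ : C} {s : LocalState C}
    (h : Acc (fun t s => LocalStep (shift ξ M) (shift ξ L) s t) s) :
    Acc (fun t s => GlobalStep M L s t) (GlobalState.running ξ s) := by
  induction h with | intro s _ ih => ?_
  refine Acc.intro _ fun t ht => ?_
  cases ht with
  | run ξ s t hst => exact ih t hst
  | fail => exact acc_returned _
  | transform_back => exact acc_returned _

/-- The invariant of the global algorithm. -/
def GlobalInvariant (M L Q : DiffOp C) : GlobalState C → Prop
  | .start => True
  | .running ξ s => IsOrdinaryPoint ξ L ∧ IsOrdinaryPoint ξ M ∧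
      LocalInvariant (shift ξ M) (shift ξ L) (shift ξ Q) s
  | .returned r => r = some Q

theorem IsColonOperator.globalInvariant_step [CharZero C] (hQ : IsColonOperator M L Q) (hL : L ≠ 0)
    {s t : GlobalState C} (hs : GlobalInvariant M L Q s) (hst : GlobalStep M L s t) :
    GlobalInvariant M L Q t := by
  cases hst with
  | choose_point ξ h1 h2 => exact ⟨h1, h2, trivial⟩
  | run ξ s t hst =>
    exact ⟨hs.1, hs.2.1, (hQ.isQuotientAtZero hL hs.1 hs.2.1).localInvariant_step hs.2.2 hst⟩
  | fail ξ => cases hs.2.2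
  | transform_back ξ P =>
    have h : some P = some (shift ξ Q) := hs.2.2
    rw [Option.some.inj h, shift_neg_shift]
    rfl

theorem IsColonOperator.alwaysEndsIn [CharZero C] (hQ : IsColonOperator M L Q) (hL : 0 < L.natDegree)
    (hM : 0 < M.natDegree) :
    AlwaysEndsIn (GlobalStep M L) GlobalState.start
      (fun s => ∃ Q, s = GlobalState.returned (some Q) ∧
        ∀ Q', IsQuasiSymQuotient M L Q' ↔ Q' = Q) := by
  have hL0 := ne_zero_of_natDegree_gt hL
  constructor
  · refine Acc.intro _ fun t ht => ?_
    cases ht with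
    | choose_point ξ h1 h2 =>
      exact acc_running ((hQ.isQuotientAtZero hL0 h1 h2).acc_entry (by rwa [natDegree_shift])
        (by rwa [natDegree_shift]) h1.isRegularAtZero_shift h2.isRegularAtZero_shift)
  · intro s hs hstuck
    have hinv : GlobalInvariant M L Q s := by
      clear hstuck
      induction hs with
      | refl => trivial
      | tail _ hst ih => exact hQ.globalInvariant_step hL0 ih hst
    cases s with
    | start =>
      obtain ⟨ξ, h1, h2, -⟩ := exists_isOrdinaryPoint L M M
      exact absurd (.choose_point ξ h1 h2) (hstuck _)
    | running ξ s =>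
      rcases (hQ.isQuotientAtZero hL0 hinv.1 hinv.2.1).exists_localStep (by rwa [natDegree_shift])
        (by rwa [natDegree_shift]) hinv.1.isRegularAtZero_shift hinv.2.1.isRegularAtZero_shift
        hinv.2.2 with ⟨t, ht⟩ | rfl
      · exact absurd (.run ξ s t ht) (hstuck _)
      · exact absurd (.transform_back ξ _) (hstuck _)
    | returned r =>
      obtain rfl : r = some Q := hinv
      exact ⟨Q, rfl, hQ.isQuasiSymQuotient_iff hL0⟩

end

end SymmetricDivision

end

open SymmetricDivision
theorem mainTheorem5 {C : Type u} [Field C] [IsAlgClosed C] [CharZero C]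
    (L M : DiffOp C) (hL : 0 < L.natDegree) (hM : 0 < M.natDegree)
    (m : ℕ) (Ls : Fin m → DiffOp C) (hLs : ∀ i, (Ls i).natDegree = 1)
    (hlclm : IsLCLM Ls L) :
    -- every run of the algorithm terminates and returns the global quasi-symmetric quotient
    AlwaysEndsIn (GlobalStep M L)
      GlobalState.start
      (fun s => ∃ Q, s = GlobalState.returned (some Q) ∧
        ∀ Q', IsQuasiSymQuotient M L Q' ↔ Q' = Q) ∧
    -- local quasi-symmetric quotients exist at the ordinary points
    ∀ ξ : C, IsOrdinaryPoint ξ L → IsOrdinaryPoint ξ M →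
      (∀ h ∈ colonSpaceAt ξ M L, IsDFiniteAt ξ h) ∧
      (∀ h ∈ colonSpaceAt ξ M L, ∀ Qh : DiffOp C,
        IsMinimalAnnihilatorAt ξ h Qh →
          solutionSpaceAt ξ Qh ≤ colonSpaceAt ξ M L ∧
          Module.rank C (solutionSpaceAt ξ Qh) = Qh.natDegree) ∧
      ∃ Q, IsLocalQuasiSymQuotient ξ M L Q := by
  have hL0 := Polynomial.ne_zero_of_natDegree_gt hL
  obtain ⟨u, hu⟩ := hlclm.exists_isExpLCLM hLs
  have hm : 0 < m := by
    by_contra hm0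
    obtain rfl : m = 0 := by omega
    -- The least common left multiple of an empty family has order `0`, against `ord L > 0`.
    have h := hu.2 1 one_ne_zero fun i => i.elim0
    rw [Polynomial.natDegree_one] at h
    omega
  obtain ⟨Q, hQ⟩ := exists_isColonOperator hL (Polynomial.ne_zero_of_natDegree_gt hM) hm hu
  exact ⟨hQ.alwaysEndsIn hL hM, fun ξ h1 h2 => hQ.local_quotients hL0 h1 h2⟩
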